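/- All graphs are finite and simple. A cactus is a graph in which any two distinct cycles are edge-disjoint, and $\beta(G)$ denotes the maximum number of triangles in a cactus subgraph of $G$. A triangular cactus is a cactus all of whose cycles are triangles and each of whose edges lies on a cycle; a maximal cactus subgraph of $G$ is a subgraph that is a triangular cactus and is not properly contained in another such subgraph of $G$. For a plane graph $H$ (a graph with a fixed drawing in the plane), $f_3(H)$ denotes the number of its faces, the unbounded one included, whose boundary is a triangle of $H$. Theorem. (a) There is a family $(H_n)$ of plane graphs, $H_n$ having $n$ vertices and $f_3(H_n)>0$ for all large $n$, that have maximal cactus subgraphs $C_n$ with $$\frac{\#\{\text{triangles of } C_n\}}{f_3(H_n)}\le \frac1{12}+o_n(1),$$ and for which $$\frac{\beta(H_n)}{f_3(H_n)}\le \frac16+o_n(1).$$ (b) Every family $(H_n)$ of $n$-vertex plane graphs, with $f_3(H_n)>0$ for all large $n$, that has maximal cactus subgraphs $C_n$ as in the first inequality also satisfies the second one. (c) If $C$ is a maximal cactus subgraph of a graph $G$, then $C$ has at least $\beta(G)/2$ triangles. (d) Consequently the constant $\frac16$ in the bound $\beta(H)\ge\frac16 f_3(H)$ for plane graphs cannot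 be improved: for every $c>\frac16$ there is a plane graph $H$ with $\beta(H)<c\,f_3(H)$. -/

import Mathlib

open Filter Topology

/-- A (simple) plane graph: a graph together with a drawing in the plane. Distinct vertices are
distinct points, an edge `uv` is drawn as a (Jordan) arc from `u` to `v`, the arc of an edge contains
no vertices except its two ends, and two distinct edges meet only in common ends. Only the topology
of the plane `ℝ × ℝ` matters. The value of `arc` at pairs that are not edges is irrelevant. -/
structure PlaneGraph (V : Type*) where
  graph : SimpleGraph V
  pos : V → ℝ × ℝ
  arc : Sym2 V → Set (ℝ × ℝ)
  pos_injective : Function.Injective pos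
  arc_isArc : ∀ u v : V, graph.Adj u v →
    ∃ γ : Path (pos u) (pos v), Function.Injective γ ∧ Set.range γ = arc s(u, v)
  mem_of_pos_mem_arc : ∀ e ∈ graph.edgeSet, ∀ w : V, pos w ∈ arc e → w ∈ e
  arc_inter_arc : ∀ e ∈ graph.edgeSet, ∀ f ∈ graph.edgeSet, e ≠ f →
    ∀ x ∈ arc e ∩ arc f, ∃ w : V, w ∈ e ∧ w ∈ f ∧ x = pos w

namespace PlaneGraph

/-- The points of the plane covered by the drawing. -/
def support {V : Type*} (H : PlaneGraph V) : Set (ℝ × ℝ) :=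
  Set.range H.pos ∪ ⋃ e ∈ H.graph.edgeSet, H.arc e

/-- A face (bounded or not) is a connected component of the complement of the drawing. -/
def IsFace {V : Type*} (H : PlaneGraph V) (F : Set (ℝ × ℝ)) : Prop :=
  ∃ x ∈ H.supportᶜ, F = connectedComponentIn H.supportᶜ x

/-- A face is triangular if its boundary is exactly (the drawing of) a triangle of the graph. -/
def IsTriangularFace {V : Type*} (H : PlaneGraph V) (F : Set (ℝ × ℝ)) : Prop :=
  H.IsFace F ∧ ∃ a b c : V, H.graph.Adj a b ∧ H.graph.Adj b c ∧ H.graph.Adj a c ∧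
    frontier F = H.arc s(a, b) ∪ H.arc s(b, c) ∪ H.arc s(a, c)

/-- `f₃(H)`, the number of triangular faces. -/
noncomputable def f₃ {V : Type*} (H : PlaneGraph V) : ℕ :=
  {F | H.IsTriangularFace F}.ncard

end PlaneGraph

/-- A cactus: any two distinct cycles are edge-disjoint. -/
def IsCactus {V : Type*} (C : SimpleGraph V) : Prop :=
  ∀ (u v : V) (p : C.Walk u u) (q : C.Walk v v), p.IsCycle → q.IsCycle →
    p.toSubgraph ≠ q.toSubgraph → p.edges.Disjoint q.edges

/-- A triangular cactus: a cactus all of whose cycles are triangles and in which every edge lies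
on a cycle. -/
def IsTriangularCactus {V : Type*} (C : SimpleGraph V) : Prop :=
  IsCactus C ∧
  (∀ (u : V) (p : C.Walk u u), p.IsCycle → p.length = 3) ∧
  (∀ e ∈ C.edgeSet, ∃ (u : V) (p : C.Walk u u), p.IsCycle ∧ e ∈ p.edges)

/-- A triangular cactus subgraph of `G` that is not properly contained in another one. Subgraphs
are taken on the full vertex set; isolated vertices play no role. -/
def IsMaximalCactus {V : Type*} (G C : SimpleGraph V) : Prop :=
  Maximal (fun C' : SimpleGraph V => C' ≤ G ∧ IsTriangularCactus C') C

/-- The number of triangles of a graph. -/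
noncomputable def numTriangles {V : Type*} (C : SimpleGraph V) : ℕ :=
  (C.cliqueSet 3).ncard

/-- The cactus number `β(G)`: the maximum number of triangles in a cactus subgraph of the (finite)
graph `G`. -/
noncomputable def cactusNumber {V : Type*} (G : SimpleGraph V) : ℕ :=
  sSup {k : ℕ | ∃ C : SimpleGraph V, C ≤ G ∧ IsCactus C ∧ numTriangles C = k}

/-- A family `H n` of `n`-vertex plane graphs (with a triangular face, for large `n`) that have
maximal cactus subgraphs `C n` with at most `(1/12 + o(1)) f₃(H n)` triangles. -/
def HasPoorMaximalCacti (H : (n : ℕ) → PlaneGraph (Fin n)) : Prop :=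
  (∀ᶠ n in atTop, 0 < (H n).f₃) ∧
  ∃ C : (n : ℕ) → SimpleGraph (Fin n),
    (∀ n, IsMaximalCactus (H n).graph (C n)) ∧
    ∃ ε : ℕ → ℝ, Tendsto ε atTop (𝓝 0) ∧
      ∀ n, (numTriangles (C n) : ℝ) / ((H n).f₃ : ℝ) ≤ 1 / 12 + ε n

/-! Part (c) is a rank argument. Attach to a graph the rational span of the vectors `e_u - e_v` over
its edges `uv`. A triangle contributes at most two dimensions, and the triangles of a cactus are
independent: a cactus with `s` triangles has rank at least `2s`
(`IsCactus.two_mul_card_le_finrank`). If `C` is maximal in `G`, every triangle of `G` has two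
vertices in one component of `C`, since otherwise it could be added to `C`. Modulo the span of `C`
each triangle of `G` thus contributes at most one dimension. For a cactus with `s` triangles and a
maximal `C` with `t` triangles this gives `2s ≤ 2t + s`, that is `s ≤ 2t`. Part (b) follows on
dividing by the number of triangular faces.

For (a), take a straight-line triangulation of a triangle on a vertex set `P` that carries a
spanning connected triangular cactus, with about `|P|/2` triangles. It has `2|P| - 5` inner faces.
Put a new vertex into almost all of them, reaching `n ≈ 3|P|` vertices and at least `2n - 5`
triangular faces. The new vertices are pairwise non-adjacent, so every triangle of the graph has two
vertices in `P`, already joined by the cactus; hence the cactus is still maximal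
(`isMaximalCactus_of_reachable`). It has about `n/6` triangles against about `2n` faces, which is
the ratio 1/12. Part (d) takes a late member of this family.

The drawing is handled by barycentric coordinates: starting from one triangle, each new vertex is
the centroid of a face, and `IsTriangulation` is the invariant kept by such insertions. -/

namespace SimpleGraph

/-! ### Cycles, paths and triangles as walks. -/

variable {V : Type*}

/-- Deleting an edge from a cycle leaves a path between its ends: rotate the cycle to start at `u`,
where the edge is either the first or the last one. -/
theorem Walk.IsCycle.exists_isPath_of_mem_edges {G : SimpleGraph V} {w u v : V} {p : G.Walk w w}
    (hp : p.IsCycle) (he : s(u, v) ∈ p.edges) :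
    ∃ q : G.Walk v u, q.IsPath ∧ s(u, v) ∉ q.edges ∧ q.length + 1 = p.length := by
  classical
  have key : ∀ c : G.Walk u u, c.IsCycle → c.snd = v →
      ∃ q : G.Walk v u, q.IsPath ∧ s(u, v) ∉ q.edges ∧ q.length + 1 = c.length := by
    intro c hc hv
    cases c with
    | nil => exact absurd hc Walk.not_isCycle_nil
    | cons h r =>
      rw [Walk.snd_cons] at hv
      subst hv
      rw [Walk.cons_isCycle_iff] at hc
      exact ⟨r, hc.1, hc.2, by simp⟩
  have hu : u ∈ p.support := p.fst_mem_support_of_mem_edges he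
  have hc := hp.rotate hu
  have he' : s(u, v) ∈ (p.rotate u hu).edges := (p.rotate_edges u hu).mem_iff.2 he
  rw [← p.length_rotate u hu]
  generalize p.rotate u hu = c at hc he'
  by_cases h : c.snd = v
  · exact key c hc h
  -- The edge comes last, so it comes first in the reversed cycle.
  · rw [← c.length_reverse]
    refine key c.reverse hc.reverse ?_
    rw [Walk.snd_reverse]
    cases c with
    | nil => exact absurd hc Walk.not_isCycle_nil
    | cons hx r =>
      rw [Walk.cons_isCycle_iff] at hc
      have hr : s(u, v) ∈ r.edges := by
        simp only [Walk.edges_cons, List.mem_cons] at he'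
        rcases he' with he' | he'
        · exact absurd (by simpa using (Sym2.congr_right.1 he').symm) h
        · exact he'
      have hn : ¬ r.Nil := by
        intro hn
        rw [Walk.edges_eq_nil.2 hn] at hr
        simp at hr
      rw [Walk.penultimate_cons_of_not_nil _ _ hn]
      exact (hc.1.eq_penultimate_of_mem_edges hr).symm

theorem exists_isCycle_of_triangle {G : SimpleGraph V} {a b c : V} (hab : G.Adj a b)
    (hbc : G.Adj b c) (hca : G.Adj c a) :
    ∃ p : G.Walk a a, p.IsCycle ∧ p.edges = [s(a, b), s(b, c), s(c, a)] ∧ p.length = 3 := by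
  refine ⟨.cons hab (.cons hbc (.cons hca .nil)), ?_, by simp, by simp⟩
  have := hab.ne; have := hbc.ne; have := hca.ne
  rw [Walk.cons_isCycle_iff]
  simp [Walk.cons_isPath_iff]
  grind

end SimpleGraph

/-! ### Triangular cacti. -/

open SimpleGraph

/-- All cycles are triangles, and every edge lies in a triangle. -/
def AllCyclesTriangles {V : Type*} (C : SimpleGraph V) : Prop :=
  (∀ (u : V) (p : C.Walk u u), p.IsCycle → p.length = 3) ∧
  ∀ a b, C.Adj a b → ∃ c, C.Adj b c ∧ C.Adj c a

section Cactus

variable {V : Type*} {C G D : SimpleGraph V}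

/-- Two different common neighbours would give the 4-cycle `a c b d`. -/
theorem AllCyclesTriangles.common_neighbor_unique (hC : AllCyclesTriangles C) {a b c d : V}
    (hab : C.Adj a b) (hbc : C.Adj b c) (hca : C.Adj c a) (hbd : C.Adj b d) (hda : C.Adj d a) :
    c = d := by
  by_contra hcd
  have hp : (Walk.cons hca.symm (.cons hbc.symm (.cons hbd (.cons hda .nil)))).IsCycle := by
    have := hab.ne; have := hbc.ne; have := hca.ne; have := hbd.ne; have := hda.ne
    rw [Walk.cons_isCycle_iff]
    simp [Walk.cons_isPath_iff]
    grind
  simpa using hC.1 _ _ hp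

/-- A cycle of length three spans the complete graph on its three vertices. -/
theorem SimpleGraph.Walk.exists_toSubgraph_of_length_three {u a b : V} {p : C.Walk u u}
    (h3 : p.length = 3) (he : s(a, b) ∈ p.edges) :
    ∃ c, C.Adj b c ∧ C.Adj c a ∧ p.toSubgraph.verts = {a, b, c} ∧
      ∀ i j, p.toSubgraph.Adj i j ↔
        i ≠ j ∧ i ∈ ({a, b, c} : Set V) ∧ j ∈ ({a, b, c} : Set V) := by
  match p, h3 with
  | .cons (v := x) hux (.cons (v := y) hxy (.cons hyu .nil)), _ =>
    have key : ∀ c, ({u, x, y} : Set V) = {a, b, c} →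
        (Walk.cons hux (.cons hxy (.cons hyu .nil))).toSubgraph.verts = {a, b, c} ∧
        ∀ i j, (Walk.cons hux (.cons hxy (.cons hyu .nil))).toSubgraph.Adj i j ↔
        i ≠ j ∧ i ∈ ({a, b, c} : Set V) ∧ j ∈ ({a, b, c} : Set V) := by
      rintro c hc
      rw [← hc]
      constructor
      · ext i
        simp
        grind
      · intro i j
        have := hux.ne; have := hxy.ne; have := hyu.ne
        simp only [Walk.adj_toSubgraph_iff_mem_edges, Walk.edges_cons, Walk.edges_nil,
          List.mem_cons, Sym2.eq_iff, Set.mem_insert_iff, Set.mem_singleton_iff]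
        simp
        grind
    simp only [Walk.edges_cons, Walk.edges_nil, List.mem_cons, List.not_mem_nil, or_false,
      Sym2.eq_iff] at he
    rcases he with (⟨rfl, rfl⟩ | ⟨rfl, rfl⟩) | (⟨rfl, rfl⟩ | ⟨rfl, rfl⟩) | (⟨rfl, rfl⟩ | ⟨rfl, rfl⟩)
    · exact ⟨_, hxy, hyu, key _ rfl⟩
    · exact ⟨_, hyu.symm, hxy.symm, key _ (by grind)⟩
    · exact ⟨_, hyu, hux, key _ (by grind)⟩
    · exact ⟨_, hux.symm, hyu.symm, key _ (by grind)⟩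
    · exact ⟨_, hux, hxy, key _ (by grind)⟩
    · exact ⟨_, hxy.symm, hux.symm, key _ (by grind)⟩

/-- Edge-disjointness of the cycles is automatic: by uniqueness of common neighbours, two triangles
with a common edge coincide. -/
theorem isTriangularCactus_iff : IsTriangularCactus C ↔ AllCyclesTriangles C := by
  constructor
  · rintro ⟨-, h3, he⟩
    refine ⟨h3, fun a b hab => ?_⟩
    obtain ⟨u, p, hp, hmem⟩ := he s(a, b) hab
    obtain ⟨q, -, -, hq⟩ := hp.exists_isPath_of_mem_edges hmem
    have hq2 : q.length = 2 := by have := h3 u p hp; omega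
    match q, hq2 with
    | .cons hbc (.cons hca .nil), _ => exact ⟨_, hbc, hca⟩
  · intro h
    refine ⟨?_, h.1, ?_⟩
    · intro u v p q hp hq hne e hep heq
      apply hne
      induction e with | _ a b
      obtain ⟨c, hbc, hca, hv, hadj⟩ :=
        Walk.exists_toSubgraph_of_length_three (h.1 _ _ hp) hep
      obtain ⟨d, hbd, hda, hv', hadj'⟩ :=
        Walk.exists_toSubgraph_of_length_three (h.1 _ _ hq) heq
      obtain rfl := h.common_neighbor_unique (p.adj_of_mem_edges hep) hbc hca hbd hda
      ext i j
      · rw [hv, hv']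
      · rw [hadj, hadj']
    · intro e he
      induction e with | _ a b
      obtain ⟨c, hbc, hca⟩ := h.2 a b he
      obtain ⟨p, hp, hpe, -⟩ := exists_isCycle_of_triangle he hbc hca
      exact ⟨a, p, hp, by simp [hpe]⟩

/-- The complete graph on a set of vertices. -/
def completeOn (S : Set V) : SimpleGraph V where
  Adj x y := x ≠ y ∧ x ∈ S ∧ y ∈ S
  symm := ⟨fun _ _ h => ⟨h.1.symm, h.2.2, h.2.1⟩⟩
  loopless := ⟨fun _ h => h.1 rfl⟩

/-- As `S` meets the component of `a` only in `a`, a walk in that component can leave it, or use an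
added edge at all, only by passing through `a`. -/
theorem reachable_of_walk_avoiding {S : Set V}
    (hS : ∀ x ∈ S, ∀ y ∈ S, C.Reachable x y → x = y) {a x y : V} (ha : a ∈ S)
    (w : (C ⊔ completeOn S).Walk x y) (hx : C.Reachable a x) (hw : a ∉ w.support) :
    C.Reachable a y := by
  induction w with
  | nil => exact hx
  | @cons x z y h w ih =>
    rw [Walk.support_cons, List.mem_cons, not_or] at hw
    rcases h with h | h
    · exact ih (hx.trans h.reachable) hw.2
    · exact absurd (hS a ha x h.2.1 hx) hw.1

/-- Joining three components of a triangular cactus by a triangle gives a triangular cactus. -/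
theorem AllCyclesTriangles.sup_completeOn (hC : AllCyclesTriangles C) {a b c : V}
    (hab : ¬ C.Reachable a b) (hbc : ¬ C.Reachable b c) (hca : ¬ C.Reachable c a) :
    AllCyclesTriangles (C ⊔ completeOn {a, b, c}) := by
  have nab : a ≠ b := by rintro rfl; exact hab .rfl
  have nbc : b ≠ c := by rintro rfl; exact hbc .rfl
  have nca : c ≠ a := by rintro rfl; exact hca .rfl
  have hS : ∀ x ∈ ({a, b, c} : Set V), ∀ y ∈ ({a, b, c} : Set V), C.Reachable x y → x = y := by
    have := fun h => hab (Reachable.symm h); have := fun h => hbc (Reachable.symm h)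
    have := fun h => hca (Reachable.symm h)
    rintro x (rfl | rfl | rfl) y (rfl | rfl | rfl) h <;> first | rfl | (exfalso; tauto)
  have h3 : ∀ x ∈ ({a, b, c} : Set V), ∀ y ∈ ({a, b, c} : Set V), ∀ z ∈ ({a, b, c} : Set V),
      ∀ t ∈ ({a, b, c} : Set V), x ≠ y → y ≠ z → z ≠ x → t ≠ y → t ≠ z → t = x := by
    rintro x (rfl | rfl | rfl) y (rfl | rfl | rfl) z (rfl | rfl | rfl) t (rfl | rfl | rfl) <;> tauto
  constructor
  · intro u p hp
    -- A cycle with an added edge `xy` leaves a path from `y` to `x`. Its first step must be an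
    -- added edge, as otherwise the path would stay in the `C`-component of `y`; so it goes to the
    -- third vertex `z`, and for the same reason from there to `x`.
    by_cases hedges : ∀ e ∈ p.edges, e ∈ C.edgeSet
    · rw [← hC.1 u _ (hp.transfer hedges), Walk.length_transfer]
    push Not at hedges
    obtain ⟨e, he, heC⟩ := hedges
    induction e with | _ x y
    obtain ⟨hxy, hx, hy⟩ : (completeOn {a, b, c}).Adj x y :=
      (p.adj_of_mem_edges he).resolve_left heC
    obtain ⟨q, hq, hqe, hlen⟩ := hp.exists_isPath_of_mem_edges he
    rw [← hlen]
    cases q with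
    | nil => exact absurd rfl hxy
    | @cons _ z _ h1 q =>
      rw [Walk.edges_cons, List.mem_cons, not_or] at hqe
      rw [Walk.cons_isPath_iff] at hq
      rcases h1 with h1 | h1
      · exact absurd (hS y hy x hx (reachable_of_walk_avoiding hS hy q h1.reachable hq.2)) hxy.symm
      obtain ⟨hyz, -, hz⟩ := h1
      have hzx : z ≠ x := by
        intro h
        exact hqe.1 (by rw [h, Sym2.eq_swap])
      cases q with
      | nil => exact absurd rfl hzx
      | @cons _ t _ h2 q =>
        rw [Walk.cons_isPath_iff, Walk.support_cons, List.mem_cons, not_or] at hq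
        rcases h2 with h2 | h2
        · exact absurd (hS z hz x hx
            (reachable_of_walk_avoiding hS hz q h2.reachable hq.1.2)) hzx
        obtain rfl : t = x := by
          refine h3 x hx y hy z hz t h2.2.2 hxy hyz hzx ?_ h2.1.symm
          rintro rfl
          exact hq.2.2 q.start_mem_support
        simp [(Walk.isPath_iff_nil.1 hq.1.1).eq_nil]
  · intro x y hxy
    rcases hxy with h | ⟨h, hx, hy⟩
    · obtain ⟨z, h1, h2⟩ := hC.2 x y h
      exact ⟨z, Or.inl h1, Or.inl h2⟩
    · obtain ⟨z, hz, h1, h2⟩ : ∃ z ∈ ({a, b, c} : Set V), y ≠ z ∧ z ≠ x := by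
        rcases hx with rfl | rfl | rfl <;> rcases hy with rfl | rfl | rfl <;> simp <;> tauto
      exact ⟨z, Or.inr ⟨h1, hy, hz⟩, Or.inr ⟨h2, hz, hx⟩⟩

end Cactus

/-! ### Ranks of cacti, and the factor two. -/

section Rank

variable {V : Type*}

theorem SimpleGraph.IsNClique.exists_third {G : SimpleGraph V} {T : Finset V}
    (hT : G.IsNClique 3 T) {x y : V} (hx : x ∈ T) (hy : y ∈ T) (hxy : x ≠ y) :
    ∃ z, (T : Set V) = {x, y, z} ∧ G.Adj x y ∧ G.Adj y z ∧ G.Adj z x := by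
  classical
  obtain ⟨a, b, c, hab, hac, hbc, rfl⟩ := is3Clique_iff.1 hT
  simp only [Finset.mem_insert, Finset.mem_singleton] at hx hy
  have h1 := hab.symm; have h2 := hac.symm; have h3 := hbc.symm
  rcases hx with rfl | rfl | rfl <;> rcases hy with rfl | rfl | rfl
  · exact absurd rfl hxy
  · exact ⟨c, by simp, hab, hbc, h2⟩
  · exact ⟨b, by ext; simp; grind, hac, h3, h1⟩
  · exact ⟨c, by ext; simp; grind, h1, hac, h3⟩
  · exact absurd rfl hxy
  · exact ⟨a, by ext; simp; grind, hbc, h2, hab⟩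
  · exact ⟨b, by ext; simp; grind, h2, hab, hbc⟩
  · exact ⟨a, by ext; simp; grind, h3, h1, hac⟩
  · exact absurd rfl hxy

/-- Cycles sharing an edge are equal in a cactus, and a triangle is determined by its edges. -/
theorem IsCactus.triangle_eq {D : SimpleGraph V} (hD : IsCactus D) {T T' : Finset V}
    (hT : D.IsNClique 3 T) (hT' : D.IsNClique 3 T') {x y : V} (hxy : x ≠ y) (hx : x ∈ T)
    (hy : y ∈ T) (hx' : x ∈ T') (hy' : y ∈ T') : T = T' := by
  obtain ⟨z, hz, h1, h2, h3⟩ := hT.exists_third hx hy hxy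
  obtain ⟨w, hw, h1', h2', h3'⟩ := hT'.exists_third hx' hy' hxy
  obtain ⟨p, hp, hpe, -⟩ := exists_isCycle_of_triangle h1 h2 h3
  obtain ⟨q, hq, hqe, -⟩ := exists_isCycle_of_triangle h1' h2' h3'
  have hpq : p.toSubgraph = q.toSubgraph := by
    by_contra hne
    exact hD _ _ p q hp hq hne (a := s(x, y)) (by simp [hpe]) (by simp [hqe])
  have h : s(y, z) ∈ q.edges := by
    rw [← Walk.adj_toSubgraph_iff_mem_edges, ← hpq, Walk.adj_toSubgraph_iff_mem_edges, hpe]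
    simp
  rw [hqe] at h
  have := h1.ne; have := h2.ne; have := h3.ne
  have : z = w := by simp at h; grind
  rw [← Finset.coe_inj, hz, hw, this]

/-- The union of the complete graphs on the members of `s`. -/
def unionOfCliques (s : Finset (Finset V)) : SimpleGraph V :=
  ⨆ T ∈ s, completeOn (T : Set V)

theorem unionOfCliques_adj {s : Finset (Finset V)} {x y : V} :
    (unionOfCliques s).Adj x y ↔ x ≠ y ∧ ∃ T ∈ s, x ∈ T ∧ y ∈ T := by
  simp only [unionOfCliques, iSup_adj, completeOn]
  simp
  tauto

/-- A path from `y` to `x` in the triangles of `s`, closed by the edge `xy`, is a cycle sharing `xy`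
with `T`, so it must be `T` itself and the path must use another edge of `T`. But no triangle of `s`
shares an edge with `T`. -/
theorem IsCactus.not_reachable {D : SimpleGraph V} (hD : IsCactus D) {s : Finset (Finset V)}
    (hs : ∀ T ∈ s, D.IsNClique 3 T) {T : Finset V} (hT : D.IsNClique 3 T) (hTs : T ∉ s)
    {x y : V} (hx : x ∈ T) (hy : y ∈ T) (hxy : x ≠ y) : ¬ (unionOfCliques s).Reachable x y := by
  intro hr
  obtain ⟨r, hrp⟩ := hr.symm.exists_isPath
  have hle : unionOfCliques s ≤ D := by
    intro i j h
    obtain ⟨hne, T', hT', hi, hj⟩ := unionOfCliques_adj.1 h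
    exact (hs T' hT').1 hi hj hne
  have hnot : ∀ i j, i ∈ T → j ∈ T → s(i, j) ∉ r.edges := by
    intro i j hi hj h
    obtain ⟨hne, T', hT', hi', hj'⟩ := unionOfCliques_adj.1 (r.adj_of_mem_edges h)
    exact hTs (hD.triangle_eq hT (hs T' hT') hne hi hj hi' hj' ▸ hT')
  obtain ⟨z, hz, h1, h2, h3⟩ := hT.exists_third hx hy hxy
  obtain ⟨p, hp, hpe, -⟩ := exists_isCycle_of_triangle h1 h2 h3
  have hc : (Walk.cons h1 (r.mapLe hle)).IsCycle := by
    rw [Walk.cons_isCycle_iff]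
    refine ⟨hrp.mapLe hle, ?_⟩
    rw [Walk.edges_mapLe_eq_edges]
    exact hnot x y hx hy
  have hpc : p.toSubgraph = (Walk.cons h1 (r.mapLe hle)).toSubgraph := by
    by_contra hne
    exact hD _ _ p _ hp hc hne (a := s(x, y)) (by simp [hpe]) (by simp)
  have h : s(y, z) ∈ (Walk.cons h1 (r.mapLe hle)).edges := by
    rw [← Walk.adj_toSubgraph_iff_mem_edges, ← hpc, Walk.adj_toSubgraph_iff_mem_edges, hpe]
    simp
  rw [Walk.edges_cons, List.mem_cons, Walk.edges_mapLe_eq_edges] at h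
  rcases h with h | h
  · have := h1.ne; have := h2.ne; have := h3.ne
    simp at h
    grind
  · exact hnot y z hy (by have : z ∈ (T : Set V) := by simp [hz]
                          exact this) h

open Classical in
/-- The span of the differences of the ends of the edges of a graph. -/
noncomputable def edgeSpace (G : SimpleGraph V) : Submodule ℚ (V → ℚ) :=
  Submodule.span ℚ {x | ∃ u v, G.Adj u v ∧ x = Pi.single u 1 - Pi.single v 1}

theorem edgeSpace_mono {G H : SimpleGraph V} (h : G ≤ H) : edgeSpace G ≤ edgeSpace H :=
  Submodule.span_mono fun _ ⟨u, v, huv, hx⟩ => ⟨u, v, h huv, hx⟩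

open Classical in
theorem edgeSpace_le {G : SimpleGraph V} {W : Submodule ℚ (V → ℚ)}
    (h : ∀ u v, G.Adj u v → (Pi.single u 1 - Pi.single v 1 : V → ℚ) ∈ W) : edgeSpace G ≤ W := by
  refine Submodule.span_le.2 ?_
  rintro _ ⟨u, v, huv, rfl⟩
  exact h u v huv

open Classical in
theorem single_sub_single_mem_edgeSpace {G : SimpleGraph V} {u v : V} (h : G.Reachable u v) :
    (Pi.single u 1 - Pi.single v 1 : V → ℚ) ∈ edgeSpace G := by
  obtain ⟨p⟩ := h
  induction p with
  | nil => simp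
  | @cons u w v h p ih =>
    rw [← sub_add_sub_cancel _ (Pi.single w 1) _]
    exact add_mem (Submodule.subset_span ⟨_, _, h, rfl⟩) ih

theorem edgeSpace_unionOfCliques_insert [DecidableEq V] (s : Finset (Finset V)) (T : Finset V) :
    edgeSpace (unionOfCliques (insert T s)) ≤
      edgeSpace (completeOn (T : Set V)) ⊔ edgeSpace (unionOfCliques s) := by
  refine edgeSpace_le fun u v huv => ?_
  obtain ⟨hne, T', hT', hu, hv⟩ := unionOfCliques_adj.1 huv
  rcases Finset.mem_insert.1 hT' with rfl | hT'
  · exact Submodule.mem_sup_left (Submodule.subset_span ⟨u, v, ⟨hne, hu, hv⟩, rfl⟩)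
  · exact Submodule.mem_sup_right
      (Submodule.subset_span ⟨u, v, unionOfCliques_adj.2 ⟨hne, T', hT', hu, hv⟩, rfl⟩)

open Classical in
theorem edgeSpace_completeOn_le {a b c : V} {W : Submodule ℚ (V → ℚ)}
    (hab : (Pi.single a 1 - Pi.single b 1 : V → ℚ) ∈ W)
    (hbc : (Pi.single b 1 - Pi.single c 1 : V → ℚ) ∈ W) :
    edgeSpace (completeOn {a, b, c}) ≤ W := by
  have hac := add_mem hab hbc
  rw [sub_add_sub_cancel] at hac
  have h1 := neg_mem hab; have h2 := neg_mem hbc; have h3 := neg_mem hac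
  rw [neg_sub] at h1 h2 h3
  refine edgeSpace_le ?_
  rintro u v ⟨-, (rfl | rfl | rfl), (rfl | rfl | rfl)⟩ <;> first | assumption | simp

/-- A triangle whose vertices lie in three different components could be added to `C`. -/
theorem IsMaximalCactus.reachable_of_triangle {G C : SimpleGraph V} (hC : IsMaximalCactus G C)
    {a b c : V} (hab : G.Adj a b) (hbc : G.Adj b c) (hca : G.Adj c a) :
    C.Reachable a b ∨ C.Reachable b c ∨ C.Reachable c a := by
  by_contra! h
  have h1 := (isTriangularCactus_iff.1 hC.1.2).sup_completeOn h.1 h.2.1 h.2.2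
  have hle : C ⊔ completeOn {a, b, c} ≤ G := by
    refine sup_le hC.1.1 ?_
    have := hab.symm; have := hbc.symm; have := hca.symm
    rintro u v ⟨hne, (rfl | rfl | rfl), (rfl | rfl | rfl)⟩ <;>
      first | assumption | exact absurd rfl hne
  have := hC.2 ⟨hle, isTriangularCactus_iff.2 h1⟩ le_sup_left
  exact h.1 (this (Or.inr ⟨hab.ne, by simp, by simp⟩ : (C ⊔ completeOn {a, b, c}).Adj a b)).reachable

variable [Finite V]

open Classical in
/-- The sum of the coordinates over the component of `a`. -/
theorem exists_component_functional (G : SimpleGraph V) (a : V) :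
    ∃ φ : (V → ℚ) →ₗ[ℚ] ℚ, (∀ x ∈ edgeSpace G, φ x = 0) ∧
      ∀ u, φ (Pi.single u 1) = if G.Reachable a u then 1 else 0 := by
  have := Fintype.ofFinite V
  let φ : (V → ℚ) →ₗ[ℚ] ℚ := ∑ v with G.Reachable a v, LinearMap.proj v
  have hφ : ∀ u, φ (Pi.single u 1) = if G.Reachable a u then 1 else 0 := by
    intro u
    simp [φ, LinearMap.sum_apply, Pi.single_apply]
  refine ⟨φ, fun x hx => ?_, fun u => by convert hφ u⟩
  have : edgeSpace G ≤ LinearMap.ker φ := by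
    refine edgeSpace_le fun u v huv => ?_
    rw [LinearMap.mem_ker, map_sub, hφ, hφ]
    have : G.Reachable a u ↔ G.Reachable a v :=
      ⟨fun h => h.trans huv.reachable, fun h => h.trans huv.symm.reachable⟩
    simp [this]
  exact this hx

theorem finrank_sup_span_singleton_le (W : Submodule ℚ (V → ℚ)) (x : V → ℚ) :
    Module.finrank ℚ ↥(W ⊔ Submodule.span ℚ {x}) ≤ Module.finrank ℚ W + 1 :=
  (Submodule.finrank_add_le_finrank_add_finrank _ _).trans
    (Nat.add_le_add_left (by
      have := finrank_span_finset_le_card (R := ℚ) {x}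
      rwa [Finset.coe_singleton, Finset.card_singleton] at this) _)

theorem finrank_lt_finrank_sup_span_singleton {W : Submodule ℚ (V → ℚ)} {x : V → ℚ} (hx : x ∉ W) :
    Module.finrank ℚ W < Module.finrank ℚ ↥(W ⊔ Submodule.span ℚ {x}) :=
  Submodule.finrank_lt_finrank_of_lt <| left_lt_sup.2 fun h =>
    hx (h (Submodule.mem_span_singleton_self x))

/-- The triangles of a cactus are independent. -/
theorem IsCactus.two_mul_card_le_finrank {D : SimpleGraph V} (hD : IsCactus D)
    (s : Finset (Finset V)) (hs : ∀ T ∈ s, D.IsNClique 3 T) :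
    2 * s.card ≤ Module.finrank ℚ (edgeSpace (unionOfCliques s)) := by
  classical
  induction s using Finset.induction_on with
  | empty => simp
  | @insert T s hTs ih =>
    have hs' : ∀ T ∈ s, D.IsNClique 3 T := fun T' h => hs T' (Finset.mem_insert_of_mem h)
    have hT := hs T (Finset.mem_insert_self _ _)
    obtain ⟨a, b, c, hab, hac, hbc, rfl⟩ := is3Clique_iff.1 hT
    have nab := hD.not_reachable hs' hT hTs (x := a) (y := b) (by simp) (by simp) hab.ne
    have nca := hD.not_reachable hs' hT hTs (x := c) (y := a) (by simp) (by simp) hac.ne'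
    have ncb := hD.not_reachable hs' hT hTs (x := c) (y := b) (by simp) (by simp) hbc.ne'
    -- The functional of the component of `a` vanishes on the old span and is 1 here, since `b` is
    -- in another component.
    have h1 : (Pi.single a 1 - Pi.single b 1 : V → ℚ) ∉ edgeSpace (unionOfCliques s) := by
      intro h
      obtain ⟨φ, hφ, hφs⟩ := exists_component_functional (unionOfCliques s) a
      have := hφ _ h
      simp [hφs, nab] at this
    -- The component of `c` contains neither `a` nor `b`, so its functional also kills the vector
    -- just added, but is -1 here.
    have h2 : (Pi.single b 1 - Pi.single c 1 : V → ℚ) ∉ edgeSpace (unionOfCliques s) ⊔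
        Submodule.span ℚ {(Pi.single a 1 - Pi.single b 1 : V → ℚ)} := by
      intro h
      obtain ⟨φ, hφ, hφs⟩ := exists_component_functional (unionOfCliques s) c
      have hle : edgeSpace (unionOfCliques s) ⊔
          Submodule.span ℚ {(Pi.single a 1 - Pi.single b 1 : V → ℚ)} ≤ LinearMap.ker φ := by
        refine sup_le (fun x hx => hφ x hx) (Submodule.span_le.2 ?_)
        simp [hφs, nca, ncb]
      have := hle h
      simp [hφs, ncb] at this
    have h3 := finrank_lt_finrank_sup_span_singleton h1
    have h4 := finrank_lt_finrank_sup_span_singleton h2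
    have hle : edgeSpace (unionOfCliques s) ⊔
        Submodule.span ℚ {(Pi.single a 1 - Pi.single b 1 : V → ℚ)} ⊔
        Submodule.span ℚ {(Pi.single b 1 - Pi.single c 1 : V → ℚ)} ≤
        edgeSpace (unionOfCliques (insert {a, b, c} s)) := by
      refine sup_le (sup_le (edgeSpace_mono ?_) ?_) ?_
      · intro x y h
        obtain ⟨hne, T', hT', hx, hy⟩ := unionOfCliques_adj.1 h
        exact unionOfCliques_adj.2 ⟨hne, T', Finset.mem_insert_of_mem hT', hx, hy⟩
      · refine Submodule.span_le.2 (Set.singleton_subset_iff.2 (Submodule.subset_span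
          ⟨a, b, unionOfCliques_adj.2 ⟨hab.ne, _, Finset.mem_insert_self _ _, ?_, ?_⟩, rfl⟩)) <;>
          simp
      · refine Submodule.span_le.2 (Set.singleton_subset_iff.2 (Submodule.subset_span
          ⟨b, c, unionOfCliques_adj.2 ⟨hbc.ne, _, Finset.mem_insert_self _ _, ?_, ?_⟩, rfl⟩)) <;>
          simp
    have h5 := Submodule.finrank_mono hle
    have := ih hs'
    rw [Finset.card_insert_of_notMem hTs]
    omega

theorem finrank_edgeSpace_unionOfCliques_le {G : SimpleGraph V} (s : Finset (Finset V))
    (hs : ∀ T ∈ s, G.IsNClique 3 T) :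
    Module.finrank ℚ (edgeSpace (unionOfCliques s)) ≤ 2 * s.card := by
  classical
  induction s using Finset.induction_on with
  | empty =>
    have : edgeSpace (unionOfCliques (∅ : Finset (Finset V))) ≤ ⊥ :=
      edgeSpace_le fun u v h => by simp [unionOfCliques_adj] at h
    rw [le_bot_iff.1 this]
    simp
  | @insert T s hTs ih =>
    have hs' : ∀ T ∈ s, G.IsNClique 3 T := fun T' h => hs T' (Finset.mem_insert_of_mem h)
    obtain ⟨a, b, c, hab, hac, hbc, rfl⟩ := is3Clique_iff.1 (hs T (Finset.mem_insert_self _ _))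
    have hle : edgeSpace (unionOfCliques (insert {a, b, c} s)) ≤ edgeSpace (unionOfCliques s) ⊔
        Submodule.span ℚ {(Pi.single a 1 - Pi.single b 1 : V → ℚ)} ⊔
        Submodule.span ℚ {(Pi.single b 1 - Pi.single c 1 : V → ℚ)} := by
      refine (edgeSpace_unionOfCliques_insert _ _).trans (sup_le ?_ (le_sup_left.trans le_sup_left))
      push_cast
      exact edgeSpace_completeOn_le
        (Submodule.mem_sup_left (Submodule.mem_sup_right (Submodule.mem_span_singleton_self _)))
        (Submodule.mem_sup_right (Submodule.mem_span_singleton_self _))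
    have h1 := Submodule.finrank_mono hle
    have h2 := finrank_sup_span_singleton_le (edgeSpace (unionOfCliques s) ⊔
        Submodule.span ℚ {(Pi.single a 1 - Pi.single b 1 : V → ℚ)}) (Pi.single b 1 - Pi.single c 1)
    have h3 := finrank_sup_span_singleton_le (edgeSpace (unionOfCliques s))
      (Pi.single a 1 - Pi.single b 1)
    have := ih hs'
    rw [Finset.card_insert_of_notMem hTs]
    omega

/-- If `a` and `b` are joined in `C`, then `e_a - e_b` is already in the span of `C`, and the
triangle `abc` adds at most the direction `e_b - e_c`. -/
theorem finrank_edgeSpace_sup_le {G C : SimpleGraph V}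
    (hC : ∀ a b c, G.Adj a b → G.Adj b c → G.Adj c a →
      C.Reachable a b ∨ C.Reachable b c ∨ C.Reachable c a)
    (s : Finset (Finset V)) (hs : ∀ T ∈ s, G.IsNClique 3 T) :
    Module.finrank ℚ ↥(edgeSpace C ⊔ edgeSpace (unionOfCliques s)) ≤
      Module.finrank ℚ (edgeSpace C) + s.card := by
  classical
  induction s using Finset.induction_on with
  | empty =>
    have : edgeSpace (unionOfCliques (∅ : Finset (Finset V))) ≤ ⊥ :=
      edgeSpace_le fun u v h => by simp [unionOfCliques_adj] at h
    exact (Submodule.finrank_mono (sup_le le_rfl (this.trans bot_le))).trans (Nat.le_add_right _ _)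
  | @insert T s hTs ih =>
    have hs' : ∀ T ∈ s, G.IsNClique 3 T := fun T' h => hs T' (Finset.mem_insert_of_mem h)
    obtain ⟨a, b, c, hT, hab⟩ :
        ∃ a b c, (T : Set V) = {a, b, c} ∧ C.Reachable a b := by
      obtain ⟨a, b, c, hab, hac, hbc, rfl⟩ := is3Clique_iff.1 (hs T (Finset.mem_insert_self _ _))
      rcases hC a b c hab hbc hac.symm with h | h | h
      · exact ⟨a, b, c, by simp, h⟩
      · exact ⟨b, c, a, by ext; simp; tauto, h⟩
      · exact ⟨c, a, b, by ext; simp; tauto, h⟩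
    have hle : edgeSpace C ⊔ edgeSpace (unionOfCliques (insert T s)) ≤
        (edgeSpace C ⊔ edgeSpace (unionOfCliques s)) ⊔
        Submodule.span ℚ {(Pi.single b 1 - Pi.single c 1 : V → ℚ)} := by
      refine sup_le (le_sup_left.trans le_sup_left) ((edgeSpace_unionOfCliques_insert _ _).trans
        (sup_le ?_ (le_sup_right.trans le_sup_left)))
      rw [hT]
      exact edgeSpace_completeOn_le
        (Submodule.mem_sup_left (Submodule.mem_sup_left (single_sub_single_mem_edgeSpace hab)))
        (Submodule.mem_sup_right (Submodule.mem_span_singleton_self _))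
    have h1 := Submodule.finrank_mono hle
    have h2 := finrank_sup_span_singleton_le (edgeSpace C ⊔ edgeSpace (unionOfCliques s))
      (Pi.single b 1 - Pi.single c 1)
    have := ih hs'
    rw [Finset.card_insert_of_notMem hTs]
    omega

theorem numTriangles_eq_card (C : SimpleGraph V) :
    ∃ s : Finset (Finset V), (∀ T, T ∈ s ↔ C.IsNClique 3 T) ∧ numTriangles C = s.card := by
  classical
  have := Fintype.ofFinite V
  refine ⟨(C.cliqueSet 3).toFinset, fun T => by simp [mem_cliqueSet_iff], ?_⟩
  rw [numTriangles, Set.ncard_eq_toFinset_card']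

/-- A maximal triangular cactus has at least half as many triangles as any cactus. -/
theorem cactusNumber_le_two_mul_numTriangles {G C : SimpleGraph V} (hC : IsMaximalCactus G C) :
    cactusNumber G ≤ 2 * numTriangles C := by
  -- `C` itself only serves to show that the set is nonempty.
  refine csSup_le ⟨_, C, hC.1.1, hC.1.2.1, rfl⟩ ?_
  rintro _ ⟨D, hDG, hD, rfl⟩
  obtain ⟨s, hs, hsc⟩ := numTriangles_eq_card D
  obtain ⟨t, ht, htc⟩ := numTriangles_eq_card C
  rw [hsc, htc]
  have h1 := hD.two_mul_card_le_finrank s fun T hT => (hs T).1 hT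
  have h2 := finrank_edgeSpace_sup_le (G := G) (C := C)
    (fun a b c => hC.reachable_of_triangle) s fun T hT => ((hs T).1 hT).mono hDG
  have h3 := finrank_edgeSpace_unionOfCliques_le t fun T hT => (ht T).1 hT
  have h4 : edgeSpace C ≤ edgeSpace (unionOfCliques t) := by
    classical
    refine edgeSpace_mono fun a b hab => ?_
    obtain ⟨c, hbc, hca⟩ := (isTriangularCactus_iff.1 hC.1.2).2 a b hab
    refine unionOfCliques_adj.2 ⟨hab.ne, {a, b, c}, (ht _).2 ?_, by simp, by simp⟩
    exact is3Clique_iff.2 ⟨a, b, c, hab, hca.symm, hbc, rfl⟩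
  have h5 := Submodule.finrank_mono h4
  have h6 := Submodule.finrank_mono
    (le_sup_right : edgeSpace (unionOfCliques s) ≤ edgeSpace C ⊔ edgeSpace (unionOfCliques s))
  -- With `r` the rank of `C`: `2|s| ≤ r + |s|` and `r ≤ 2|t|`.
  omega

/-- A cactus whose edges lie in `M` has at most `|M| / 2` triangles. -/
theorem IsCactus.two_mul_numTriangles_le {D : SimpleGraph V} (hD : IsCactus D) (M : Finset V)
    (hM : ∀ u v, D.Adj u v → u ∈ M) : 2 * numTriangles D ≤ M.card := by
  classical
  obtain ⟨s, hs, hsc⟩ := numTriangles_eq_card D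
  rw [hsc]
  refine (hD.two_mul_card_le_finrank s fun T hT => (hs T).1 hT).trans ?_
  -- The span lies in the coordinate space of `M`. The sharper dimension `|M| - 1` is not needed.
  have hle : edgeSpace (unionOfCliques s) ≤
      Submodule.span ℚ ((M.image fun v => (Pi.single v 1 : V → ℚ)) : Finset (V → ℚ)) := by
    refine edgeSpace_le fun u v huv => ?_
    obtain ⟨hne, T, hT, hu, hv⟩ := unionOfCliques_adj.1 huv
    have hadj := ((hs T).1 hT).1 hu hv hne
    exact sub_mem (Submodule.subset_span (by simpa using ⟨u, hM u v hadj, rfl⟩))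
      (Submodule.subset_span (by simpa using ⟨v, hM v u hadj.symm, rfl⟩))
  exact (Submodule.finrank_mono hle).trans
    ((finrank_span_finset_le_card _).trans Finset.card_image_le)

end Rank

/-! ### Barycentric coordinates in plane triangles. -/

section Triangles

/-- Twice the signed area of the triangle `a b x`. -/
def cross (a b x : ℝ × ℝ) : ℝ := (b.1 - a.1) * (x.2 - a.2) - (b.2 - a.2) * (x.1 - a.1)

/-- The centroid of a triangle. -/
noncomputable def centroid (a b c : ℝ × ℝ) : ℝ × ℝ := ((a.1 + b.1 + c.1) / 3, (a.2 + b.2 + c.2) / 3)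

/-- The interior of a positively oriented triangle. -/
def openTriangle (a b c : ℝ × ℝ) : Set (ℝ × ℝ) :=
  {x | 0 < cross b c x ∧ 0 < cross c a x ∧ 0 < cross a b x}

/-- The points of a positively oriented triangle. -/
def closedTriangle (a b c : ℝ × ℝ) : Set (ℝ × ℝ) :=
  {x | 0 ≤ cross b c x ∧ 0 ≤ cross c a x ∧ 0 ≤ cross a b x}

variable {a b c x y : ℝ × ℝ}

theorem cross_rotate (a b c : ℝ × ℝ) : cross b c a = cross a b c := by
  simp only [cross]; ring

theorem centroid_rotate (a b c : ℝ × ℝ) : centroid b c a = centroid a b c := by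
  simp only [centroid, Prod.mk.injEq]; constructor <;> ring

@[simp] theorem cross_self_left (a b : ℝ × ℝ) : cross a b a = 0 := by simp only [cross]; ring

@[simp] theorem cross_self_right (a b : ℝ × ℝ) : cross a b b = 0 := by simp only [cross]; ring

theorem cross_add_cross_add_cross (a b c x : ℝ × ℝ) :
    cross b c x + cross c a x + cross a b x = cross a b c := by
  simp only [cross]; ring

theorem cross_smul_add_smul (a b x y : ℝ × ℝ) {s t : ℝ} (h : s + t = 1) :
    cross a b (s • x + t • y) = s * cross a b x + t * cross a b y := by
  obtain rfl : s = 1 - t := by linarith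
  simp only [cross, Prod.fst_add, Prod.snd_add, Prod.smul_fst, Prod.smul_snd, smul_eq_mul]
  ring

theorem cross_centroid (a b c : ℝ × ℝ) : cross a b (centroid a b c) = cross a b c / 3 := by
  simp only [cross, centroid]; ring

/-- The side of a line through the centroid and a vertex is decided by comparing two barycentric
coordinates of `x`. With `cross_centroid_right`, this turns the three subtriangles at the centroid
into the regions where one given coordinate is strictly the smallest. -/
theorem cross_centroid_left (a b c x : ℝ × ℝ) :
    cross (centroid a b c) a x = (cross c a x - cross a b x) / 3 := by
  simp only [cross, centroid]; ring

theorem cross_centroid_right (a b c x : ℝ × ℝ) :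
    cross b (centroid a b c) x = (cross b c x - cross a b x) / 3 := by
  simp only [cross, centroid]; ring

/-- The expression of a point in barycentric coordinates. -/
theorem cross_smul_eq (a b c x : ℝ × ℝ) :
    cross a b c * x.1 = cross b c x * a.1 + cross c a x * b.1 + cross a b x * c.1 ∧
    cross a b c * x.2 = cross b c x * a.2 + cross c a x * b.2 + cross a b x * c.2 := by
  simp only [cross]; constructor <;> ring

theorem eq_of_cross_eq (h : 0 < cross a b c) (h1 : cross b c x = cross b c y)
    (h2 : cross c a x = cross c a y) : x = y := by
  have h3 : cross a b x = cross a b y := by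
    have := cross_add_cross_add_cross a b c x
    have := cross_add_cross_add_cross a b c y
    linarith
  obtain ⟨hx1, hx2⟩ := cross_smul_eq a b c x
  obtain ⟨hy1, hy2⟩ := cross_smul_eq a b c y
  rw [h1, h2, h3] at hx1 hx2
  exact Prod.ext (mul_left_cancel₀ h.ne' (hx1.trans hy1.symm))
    (mul_left_cancel₀ h.ne' (hx2.trans hy2.symm))

theorem eq_of_cross_eq_zero (h : 0 < cross a b c) (h1 : cross a b x = 0) (h2 : cross b c x = 0) :
    x = b := by
  refine eq_of_cross_eq h (by simp [h2]) ?_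
  have := cross_add_cross_add_cross a b c x
  have := cross_rotate b c a
  have := cross_rotate a b c
  linarith

theorem mem_segment_iff_cross (h : 0 < cross a b c) :
    x ∈ segment ℝ a b ↔ cross a b x = 0 ∧ 0 ≤ cross b c x ∧ 0 ≤ cross c a x := by
  have hr := cross_rotate a b c
  have hr' := cross_rotate b c a
  constructor
  · rintro ⟨s, t, hs, ht, hst, rfl⟩
    simp only [cross_smul_add_smul _ _ _ _ hst, cross_self_left, cross_self_right, hr, hr']
    refine ⟨by ring, ?_, ?_⟩ <;> positivity
  · rintro ⟨h0, h1, h2⟩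
    have hsum := cross_add_cross_add_cross a b c x
    obtain ⟨e1, e2⟩ := cross_smul_eq a b c x
    refine ⟨cross b c x / cross a b c, cross c a x / cross a b c, by positivity, by positivity, ?_, ?_⟩
    · field_simp; linarith
    · ext
      · simp only [Prod.fst_add, Prod.smul_fst, smul_eq_mul]; field_simp
        rw [e1, h0]; ring
      · simp only [Prod.snd_add, Prod.smul_snd, smul_eq_mul]; field_simp
        rw [e2, h0]; ring

/-- The segment from the centroid to `c` is where the coordinates at `a` and `b` agree, are
nonnegative and do not exceed the one at `c`. -/
theorem mem_segment_centroid_iff (h : 0 < cross a b c) :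
    x ∈ segment ℝ (centroid a b c) c ↔
      cross b c x = cross c a x ∧ 0 ≤ cross b c x ∧ cross b c x ≤ cross a b x := by
  have hr := cross_rotate a b c
  have hr' := cross_rotate b c a
  have c1 := cross_centroid a b c
  have c2 := cross_centroid b c a
  have c3 := cross_centroid c a b
  rw [centroid_rotate, hr] at c2
  rw [centroid_rotate, centroid_rotate, hr', hr] at c3
  constructor
  · rintro ⟨s, t, hs, ht, hst, rfl⟩
    simp only [cross_smul_add_smul _ _ _ _ hst, cross_self_left, cross_self_right, c1, c2, c3]
    refine ⟨trivial, by positivity, ?_⟩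
    have : 0 ≤ t * cross a b c := by positivity
    linarith
  · rintro ⟨h0, h1, h2⟩
    have hsum := cross_add_cross_add_cross a b c x
    obtain ⟨e1, e2⟩ := cross_smul_eq a b c x
    refine ⟨3 * cross b c x / cross a b c, (cross a b x - cross b c x) / cross a b c,
      by positivity, div_nonneg (by linarith) h.le, ?_, ?_⟩
    · field_simp; linarith
    · ext
      · simp only [Prod.fst_add, Prod.smul_fst, smul_eq_mul, centroid]; field_simp
        rw [e1, ← h0]; ring
      · simp only [Prod.snd_add, Prod.smul_snd, smul_eq_mul, centroid]; field_simp
        rw [e2, ← h0]; ring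

theorem continuous_cross (a b : ℝ × ℝ) : Continuous (cross a b) := by
  unfold cross; fun_prop

theorem isOpen_openTriangle (a b c : ℝ × ℝ) : IsOpen (openTriangle a b c) :=
  (isOpen_lt continuous_const (continuous_cross b c)).inter
    ((isOpen_lt continuous_const (continuous_cross c a)).inter
      (isOpen_lt continuous_const (continuous_cross a b)))

theorem isClosed_closedTriangle (a b c : ℝ × ℝ) : IsClosed (closedTriangle a b c) :=
  (isClosed_le continuous_const (continuous_cross b c)).inter
    ((isClosed_le continuous_const (continuous_cross c a)).inter
      (isClosed_le continuous_const (continuous_cross a b)))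

theorem convex_openTriangle (a b c : ℝ × ℝ) : Convex ℝ (openTriangle a b c) := by
  rintro x ⟨x1, x2, x3⟩ y ⟨y1, y2, y3⟩ s t hs ht hst
  have key : ∀ p q : ℝ, 0 < p → 0 < q → 0 < s * p + t * q := by
    intro p q hp hq
    rcases hs.eq_or_lt with rfl | hs
    · obtain rfl : t = 1 := by linarith
      simpa using hq
    · positivity
  simp only [openTriangle, Set.mem_ofPred_eq, cross_smul_add_smul _ _ _ _ hst]
  exact ⟨key _ _ x1 y1, key _ _ x2 y2, key _ _ x3 y3⟩

theorem convex_cross_neg (a b : ℝ × ℝ) : Convex ℝ {x | cross a b x < 0} := by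
  intro x hx y hy s t hs ht hst
  simp only [Set.mem_ofPred_eq, cross_smul_add_smul _ _ _ _ hst] at *
  rcases hs.eq_or_lt with rfl | hs
  · obtain rfl : t = 1 := by linarith
    simpa using hy
  · have := mul_neg_of_pos_of_neg hs hx
    have := mul_nonpos_of_nonneg_of_nonpos ht hy.le
    linarith

theorem centroid_mem_openTriangle (h : 0 < cross a b c) :
    centroid a b c ∈ openTriangle a b c := by
  have hr := cross_rotate a b c
  have hr' := cross_rotate b c a
  have c1 := cross_centroid a b c
  have c2 := cross_centroid b c a
  have c3 := cross_centroid c a b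
  rw [centroid_rotate, hr] at c2
  rw [centroid_rotate, centroid_rotate, hr', hr] at c3
  simp only [openTriangle, Set.mem_ofPred_eq, c1, c2, c3]
  refine ⟨?_, ?_, ?_⟩ <;> positivity

theorem frontier_openTriangle (h : 0 < cross a b c) :
    frontier (openTriangle a b c) = segment ℝ a b ∪ segment ℝ b c ∪ segment ℝ c a := by
  have hbc : 0 < cross b c a := by rwa [cross_rotate]
  have hca : 0 < cross c a b := by rwa [cross_rotate]
  rw [(isOpen_openTriangle a b c).frontier_eq]
  have hsub : openTriangle a b c ⊆ closedTriangle a b c := fun x hx => ⟨hx.1.le, hx.2.1.le, hx.2.2.le⟩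
  have hcl : closure (openTriangle a b c) = closedTriangle a b c := by
    refine (closure_minimal hsub (isClosed_closedTriangle a b c)).antisymm ?_
    rintro x ⟨x1, x2, x3⟩
    obtain ⟨q1, q2, q3⟩ := centroid_mem_openTriangle h
    -- Moving from the boundary towards the centroid makes all coordinates positive, so every
    -- closed-triangle point is a limit of interior points.
    have hs : openSegment ℝ (centroid a b c) x ⊆ openTriangle a b c := by
      rintro _ ⟨s, t, hs, ht, hst, rfl⟩
      simp only [openTriangle, Set.mem_ofPred_eq, cross_smul_add_smul _ _ _ _ hst]
      refine ⟨?_, ?_, ?_⟩ <;> positivity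
    refine closure_mono hs ?_
    rw [closure_openSegment]
    exact right_mem_segment _ _ _
  rw [hcl]
  ext x
  simp only [Set.mem_sdiff, Set.mem_union, mem_segment_iff_cross h, mem_segment_iff_cross hbc,
    mem_segment_iff_cross hca, openTriangle, closedTriangle, Set.mem_ofPred_eq]
  grind

end Triangles

/-! ### Straight-line triangulations and insertion of a centroid. -/

section Triangulations

/-- The straight segment joining the two ends of an edge. -/
def edgeSegment : Sym2 (ℝ × ℝ) → Set (ℝ × ℝ) :=
  Sym2.lift ⟨fun a b => segment ℝ a b, segment_symm ℝ⟩

@[simp] theorem edgeSegment_mk (a b : ℝ × ℝ) : edgeSegment s(a, b) = segment ℝ a b := rfl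

/-- A triangulation of the triangle `a b c` with vertices `P`, edges `E` and a list `L` of
positively oriented triangles. -/
structure IsTriangulation (a b c : ℝ × ℝ) (P : Finset (ℝ × ℝ)) (E : Set (Sym2 (ℝ × ℝ)))
    (L : List ((ℝ × ℝ) × (ℝ × ℝ) × (ℝ × ℝ))) : Prop where
  mem_of_edge : ∀ e ∈ E, ∀ v ∈ e, v ∈ P
  not_isDiag : ∀ e ∈ E, ¬ e.IsDiag
  vertex : ∀ e ∈ E, ∀ p ∈ P, p ∈ edgeSegment e → p ∈ e
  inter : ∀ e ∈ E, ∀ f ∈ E, e ≠ f → ∀ x ∈ edgeSegment e, x ∈ edgeSegment f → x ∈ P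
  pos : ∀ T ∈ L, 0 < cross T.1 T.2.1 T.2.2
  edges : ∀ T ∈ L, s(T.1, T.2.1) ∈ E ∧ s(T.2.1, T.2.2) ∈ E ∧ s(T.2.2, T.1) ∈ E
  empty : ∀ T ∈ L, ∀ x ∈ openTriangle T.1 T.2.1 T.2.2, x ∉ P ∧ ∀ e ∈ E, x ∉ edgeSegment e
  disjoint : L.Pairwise fun T T' =>
    Disjoint (openTriangle T.1 T.2.1 T.2.2) (openTriangle T'.1 T'.2.1 T'.2.2)
  cover : ∀ x, x ∈ closedTriangle a b c ↔
    x ∈ P ∨ (∃ e ∈ E, x ∈ edgeSegment e) ∨ ∃ T ∈ L, x ∈ openTriangle T.1 T.2.1 T.2.2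
  card : L.length + 5 = 2 * P.card

variable {a₀ b₀ c₀ : ℝ × ℝ} {P : Finset (ℝ × ℝ)} {E : Set (Sym2 (ℝ × ℝ))}
  {L L' : List ((ℝ × ℝ) × (ℝ × ℝ) × (ℝ × ℝ))}

/-- Insertion subdivides the head of the list, so reordering selects the triangle to be subdivided.
-/
theorem IsTriangulation.perm (h : IsTriangulation a₀ b₀ c₀ P E L) (hL : L.Perm L') :
    IsTriangulation a₀ b₀ c₀ P E L' where
  mem_of_edge := h.mem_of_edge
  not_isDiag := h.not_isDiag
  vertex := h.vertex
  inter := h.inter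
  pos T hT := h.pos T (hL.mem_iff.2 hT)
  edges T hT := h.edges T (hL.mem_iff.2 hT)
  empty T hT := h.empty T (hL.mem_iff.2 hT)
  disjoint := h.disjoint.perm hL fun h => h.symm
  cover x := by simpa only [hL.mem_iff] using h.cover x
  card := by rw [← hL.length_eq, h.card]

theorem isTriangulation_triangle {a b c : ℝ × ℝ} (h : 0 < cross a b c) :
    IsTriangulation a b c {a, b, c} {s(a, b), s(b, c), s(c, a)} [(a, b, c)] := by
  have hbc : 0 < cross b c a := by rwa [cross_rotate]
  have hca : 0 < cross c a b := by rwa [cross_rotate]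
  have nab : a ≠ b := by rintro rfl; simp at hbc
  have nbc : b ≠ c := by rintro rfl; simp at h
  have nca : c ≠ a := by rintro rfl; simp at h
  have sab := fun x => mem_segment_iff_cross (x := x) h
  have sbc := fun x => mem_segment_iff_cross (x := x) hbc
  have sca := fun x => mem_segment_iff_cross (x := x) hca
  have rbc := cross_rotate a b c
  have rca := cross_rotate b c a
  have ea := fun x => eq_of_cross_eq_zero (x := x) hca
  have eb := fun x => eq_of_cross_eq_zero (x := x) h
  have ec := fun x => eq_of_cross_eq_zero (x := x) hbc
  constructor
  · rintro e (rfl | rfl | rfl) v hv <;> rw [Sym2.mem_iff] at hv <;>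
      rcases hv with rfl | rfl <;> simp
  · simp [nab, nbc, nca]
  · simp [sab, sbc, sca, h.ne', hbc.ne', hca.ne']
  · rintro e (rfl | rfl | rfl) f (rfl | rfl | rfl) hef x hxe hxf
    all_goals first
      | exact absurd rfl hef
      | (simp only [edgeSegment_mk, sab, sbc, sca] at hxe hxf
         simp only [Finset.mem_insert, Finset.mem_singleton]
         grind)
  · simpa using h
  · simp
  · simp only [List.mem_singleton, forall_eq, Finset.mem_insert, Finset.mem_singleton,
      Set.mem_insert_iff, Set.mem_singleton_iff, forall_eq_or_imp, edgeSegment_mk, sab, sbc, sca]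
    rintro x ⟨h1, h2, h3⟩
    refine ⟨?_, by grind, by grind, by grind⟩
    rintro (rfl | rfl | rfl) <;> simp at h1 h2 h3
  · simp
  · intro x
    simp only [List.mem_singleton, exists_eq_left, Finset.mem_insert, Finset.mem_singleton,
      Set.mem_insert_iff, Set.mem_singleton_iff, exists_eq_or_imp, edgeSegment_mk, sab, sbc, sca,
      openTriangle, closedTriangle, Set.mem_ofPred_eq]
    constructor
    · grind
    · rintro ((rfl | rfl | rfl) | h | h)
      · simp [hbc.le]
      · simp [hca.le]
      · simp [h.le]
      · grind
      · grind
  · rw [Finset.card_eq_three.2 ⟨a, b, c, nab, nca.symm, nbc, rfl⟩]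
    simp

/-- Inserting the centroid of a triangle of a triangulation as a new vertex. -/
theorem IsTriangulation.insert_centroid {a b c : ℝ × ℝ}
    (h : IsTriangulation a₀ b₀ c₀ P E ((a, b, c) :: L)) :
    IsTriangulation a₀ b₀ c₀ (insert (centroid a b c) P)
      (insert s(centroid a b c, a) (insert s(centroid a b c, b) (insert s(centroid a b c, c) E)))
      ((a, b, centroid a b c) :: (b, c, centroid a b c) :: (c, a, centroid a b c) :: L) := by
  have hpos : 0 < cross a b c := h.pos _ List.mem_cons_self
  have hbc : 0 < cross b c a := by rwa [cross_rotate]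
  have hca : 0 < cross c a b := by rwa [cross_rotate]
  obtain ⟨hab_mem, hbc_mem, hca_mem⟩ : s(a, b) ∈ E ∧ s(b, c) ∈ E ∧ s(c, a) ∈ E := h.edges _ List.mem_cons_self
  have haP : a ∈ P := h.mem_of_edge _ hab_mem _ (by simp)
  have hbP : b ∈ P := h.mem_of_edge _ hbc_mem _ (by simp)
  have hcP : c ∈ P := h.mem_of_edge _ hca_mem _ (by simp)
  have hO := h.empty _ List.mem_cons_self
  have hd := List.pairwise_cons.1 h.disjoint
  have hqO := centroid_mem_openTriangle hpos
  have hqe := cross_centroid a b c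
  have hqe2 : cross b c (centroid a b c) = cross a b c / 3 := by
    rw [← centroid_rotate, cross_centroid, cross_rotate]
  have hqe3 : cross c a (centroid a b c) = cross a b c / 3 := by
    rw [← centroid_rotate, ← centroid_rotate, cross_centroid, cross_rotate, cross_rotate]
  have sc := fun x => mem_segment_centroid_iff (x := x) hpos
  have sa := fun x => mem_segment_centroid_iff (x := x) hbc
  have sb := fun x => mem_segment_centroid_iff (x := x) hca
  -- Each new triangle is where the coordinate of the vertex it omits is positive and strictly
  -- smallest.
  have tc : ∀ x, x ∈ openTriangle a b (centroid a b c) ↔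
      cross a b x < cross b c x ∧ cross a b x < cross c a x ∧ 0 < cross a b x := by
    intro x
    simp only [openTriangle, Set.mem_ofPred_eq, cross_centroid_left, cross_centroid_right]
    constructor <;> rintro ⟨h1, h2, h3⟩ <;> refine ⟨?_, ?_, ?_⟩ <;> linarith
  have ta : ∀ x, x ∈ openTriangle b c (centroid a b c) ↔
      cross b c x < cross c a x ∧ cross b c x < cross a b x ∧ 0 < cross b c x := by
    intro x
    rw [← centroid_rotate]
    simp only [openTriangle, Set.mem_ofPred_eq, cross_centroid_left, cross_centroid_right]
    constructor <;> rintro ⟨h1, h2, h3⟩ <;> refine ⟨?_, ?_, ?_⟩ <;> linarith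
  have tb : ∀ x, x ∈ openTriangle c a (centroid a b c) ↔
      cross c a x < cross a b x ∧ cross c a x < cross b c x ∧ 0 < cross c a x := by
    intro x
    rw [← centroid_rotate, ← centroid_rotate]
    simp only [openTriangle, Set.mem_ofPred_eq, cross_centroid_left, cross_centroid_right]
    constructor <;> rintro ⟨h1, h2, h3⟩ <;> refine ⟨?_, ?_, ?_⟩ <;> linarith
  rw [centroid_rotate] at sa
  rw [centroid_rotate, centroid_rotate] at sb
  have hOx : ∀ x, x ∈ openTriangle a b c ↔ 0 < cross b c x ∧ 0 < cross c a x ∧ 0 < cross a b x :=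
    fun x => Iff.rfl
  have hq_eq : ∀ x, cross b c x = cross c a x → cross c a x = cross a b x →
      x = centroid a b c := by
    intro x h1 h2
    have := cross_add_cross_add_cross a b c x
    exact eq_of_cross_eq hpos (by rw [hqe2]; linarith) (by rw [hqe3]; linarith)
  have hvert : ∀ v, v = a ∨ v = b ∨ v = c → v ∈ P := by
    rintro v (rfl | rfl | rfl) <;> assumption
  have ea := fun x => eq_of_cross_eq_zero (x := x) hca
  have eb := fun x => eq_of_cross_eq_zero (x := x) hpos
  have ec := fun x => eq_of_cross_eq_zero (x := x) hbc
  generalize centroid a b c = q at *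
  have hqP : q ∉ P := (hO q hqO).1
  -- Except for its old end, a new edge lies inside the open face, which contains no old vertex or
  -- edge point. So it meets the old drawing only in that end.
  have hseg : ∀ v, v = a ∨ v = b ∨ v = c → ∀ x ∈ segment ℝ q v,
      x = v ∨ x ∈ openTriangle a b c := by
    rintro v (rfl | rfl | rfl) x hx
    · rw [sa] at hx; rw [hOx]; grind
    · rw [sb] at hx; rw [hOx]; grind
    · rw [sc] at hx; rw [hOx]; grind
  have hE : ∀ e, e ∈ insert s(q, a) (insert s(q, b) (insert s(q, c) E)) ↔
      (∃ v, (v = a ∨ v = b ∨ v = c) ∧ e = s(q, v)) ∨ e ∈ E := by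
    intro e
    simp only [Set.mem_insert_iff]
    grind
  have hsub : ∀ T ∈ [(a, b, q), (b, c, q), (c, a, q)], ∀ x ∈ openTriangle T.1 T.2.1 T.2.2,
      x ∈ openTriangle a b c ∧ ∀ v, v = a ∨ v = b ∨ v = c → x ∉ segment ℝ q v := by
    intro T hT x hx
    simp only [List.mem_cons, List.not_mem_nil, or_false] at hT
    rcases hT with rfl | rfl | rfl
    all_goals
      simp only [ta, tb, tc] at hx
      obtain ⟨h1, h2, h3⟩ := hx
      refine ⟨(hOx x).2 ⟨by linarith, by linarith, by linarith⟩, ?_⟩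
      rintro v (rfl | rfl | rfl) hv
      · obtain ⟨h4, h5, h6⟩ := (sa x).1 hv
        linarith
      · obtain ⟨h4, h5, h6⟩ := (sb x).1 hv
        linarith
      · obtain ⟨h4, h5, h6⟩ := (sc x).1 hv
        linarith
  have hcov : ∀ x ∈ openTriangle a b c, (∃ v, (v = a ∨ v = b ∨ v = c) ∧ x ∈ segment ℝ q v) ∨
      ∃ T ∈ [(a, b, q), (b, c, q), (c, a, q)], x ∈ openTriangle T.1 T.2.1 T.2.2 := by
    intro x
    simp only [List.mem_cons, List.not_mem_nil, or_false, exists_eq_or_imp, exists_eq_left, ta, tb,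
      tc, sa, sb, sc, hOx]
    grind
  have hL : ∀ T, T ∈ (a, b, q) :: (b, c, q) :: (c, a, q) :: L ↔
      T ∈ [(a, b, q), (b, c, q), (c, a, q)] ∨ T ∈ L := by
    intro T; simp [or_assoc]
  constructor
  · intro e he v hv
    rw [hE] at he
    rw [Finset.mem_insert]
    rcases he with ⟨w, hw, rfl⟩ | he
    · rcases Sym2.mem_iff.1 hv with rfl | rfl
      · exact Or.inl rfl
      · exact Or.inr (hvert _ hw)
    · exact Or.inr (h.mem_of_edge e he v hv)
  · intro e he
    rcases (hE e).1 he with ⟨w, hw, rfl⟩ | he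
    · rw [Sym2.mk_isDiag_iff]
      rintro rfl
      exact hqP (hvert _ hw)
    · exact h.not_isDiag e he
  · intro e he p hp hpe
    rcases (hE e).1 he with ⟨w, hw, rfl⟩ | he' <;> rcases Finset.mem_insert.1 hp with rfl | hp
    · simp
    · rcases hseg w hw p hpe with rfl | hpO
      · simp
      · exact absurd hp (hO p hpO).1
    · exact absurd hpe ((hO p hqO).2 e he')
    · exact h.vertex e he' p hp hpe
  · have key : ∀ w, w = a ∨ w = b ∨ w = c → ∀ f ∈ E, ∀ x ∈ segment ℝ q w, x ∈ edgeSegment f →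
        x ∈ P := by
      intro w hw f hf x hxw hxf
      rcases hseg w hw x hxw with rfl | hxO
      · exact hvert _ hw
      · exact absurd hxf ((hO x hxO).2 f hf)
    intro e he f hf hef x hxe hxf
    rcases (hE e).1 he with ⟨w, hw, rfl⟩ | he <;> rcases (hE f).1 hf with ⟨w', hw', rfl⟩ | hf
    · rw [edgeSegment_mk] at hxe hxf
      obtain rfl : x = q := by
        rcases hw with rfl | rfl | rfl <;> rcases hw' with rfl | rfl | rfl
        all_goals first
          | exact absurd rfl hef
          | (simp only [sa, sb, sc] at hxe hxf
             apply hq_eq <;> grind)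
      exact Finset.mem_insert_self _ _
    · exact Finset.mem_insert_of_mem (key w hw f hf x hxe hxf)
    · exact Finset.mem_insert_of_mem (key w' hw' e he x hxf hxe)
    · exact Finset.mem_insert_of_mem (h.inter e he f hf hef x hxe hxf)
  · simp only [List.mem_cons, forall_eq_or_imp]
    refine ⟨?_, ?_, ?_, fun T hT => h.pos T (List.mem_cons_of_mem _ hT)⟩ <;> linarith
  · simp only [List.mem_cons, forall_eq_or_imp]
    refine ⟨?_, ?_, ?_, fun T hT => ?_⟩
    · exact ⟨(hE _).2 (Or.inr hab_mem), (hE _).2 (Or.inl ⟨b, by simp, Sym2.eq_swap⟩),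
        (hE _).2 (Or.inl ⟨a, by simp, rfl⟩)⟩
    · exact ⟨(hE _).2 (Or.inr hbc_mem), (hE _).2 (Or.inl ⟨c, by simp, Sym2.eq_swap⟩),
        (hE _).2 (Or.inl ⟨b, by simp, rfl⟩)⟩
    · exact ⟨(hE _).2 (Or.inr hca_mem), (hE _).2 (Or.inl ⟨a, by simp, Sym2.eq_swap⟩),
        (hE _).2 (Or.inl ⟨c, by simp, rfl⟩)⟩
    · have := h.edges T (List.mem_cons_of_mem _ hT)
      simp only [Set.mem_insert_iff]
      tauto
  · intro T hT x hx
    rcases (hL T).1 hT with hT | hT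
    · obtain ⟨hxO, hxs⟩ := hsub T hT x hx
      refine ⟨?_, fun e he => ?_⟩
      · rw [Finset.mem_insert, not_or]
        refine ⟨?_, (hO x hxO).1⟩
        rintro rfl
        exact hxs a (Or.inl rfl) (left_mem_segment _ _ _)
      · rcases (hE e).1 he with ⟨w, hw, rfl⟩ | he
        · exact hxs w hw
        · exact (hO x hxO).2 e he
    · have hxO : x ∉ openTriangle a b c := fun hxO => Set.disjoint_left.1 (hd.1 T hT) hxO hx
      obtain ⟨hxP, hxE⟩ := h.empty T (List.mem_cons_of_mem _ hT) x hx
      refine ⟨?_, fun e he => ?_⟩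
      · rw [Finset.mem_insert, not_or]
        refine ⟨?_, hxP⟩
        rintro rfl
        exact hxO hqO
      · rcases (hE e).1 he with ⟨w, hw, rfl⟩ | he
        · intro hxe
          rcases hseg w hw x hxe with rfl | hxO'
          · exact hxP (hvert _ hw)
          · exact hxO hxO'
        · exact hxE e he
  · have hdL : ∀ T ∈ [(a, b, q), (b, c, q), (c, a, q)], ∀ T' ∈ L,
        Disjoint (openTriangle T.1 T.2.1 T.2.2) (openTriangle T'.1 T'.2.1 T'.2.2) :=
      fun T hT T' hT' => (hd.1 T' hT').mono_left fun x hx => (hsub T hT x hx).1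
    have h1 : Disjoint (openTriangle a b q) (openTriangle b c q) :=
      Set.disjoint_left.2 fun x => by rw [tc, ta]; grind
    have h2 : Disjoint (openTriangle a b q) (openTriangle c a q) :=
      Set.disjoint_left.2 fun x => by rw [tc, tb]; grind
    have h3 : Disjoint (openTriangle b c q) (openTriangle c a q) :=
      Set.disjoint_left.2 fun x => by rw [ta, tb]; grind
    simp only [List.pairwise_cons, List.mem_cons, forall_eq_or_imp]
    exact ⟨⟨h1, h2, hdL (a, b, q) (by simp)⟩, ⟨h3, hdL (b, c, q) (by simp)⟩,
      hdL (c, a, q) (by simp), hd.2⟩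
  · intro x
    rw [h.cover x]
    constructor
    · rintro (hx | ⟨e, he, hx⟩ | ⟨T, hT, hx⟩)
      · exact Or.inl (Finset.mem_insert_of_mem hx)
      · exact Or.inr (Or.inl ⟨e, (hE e).2 (Or.inr he), hx⟩)
      · rcases List.mem_cons.1 hT with rfl | hT
        · rcases hcov x hx with ⟨v, hv, hxv⟩ | ⟨T, hT, hx⟩
          · exact Or.inr (Or.inl ⟨_, (hE _).2 (Or.inl ⟨v, hv, rfl⟩), hxv⟩)
          · exact Or.inr (Or.inr ⟨T, (hL T).2 (Or.inl hT), hx⟩)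
        · exact Or.inr (Or.inr ⟨T, (hL T).2 (Or.inr hT), hx⟩)
    · have hO' : x ∈ openTriangle a b c → x ∈ P ∨ (∃ e ∈ E, x ∈ edgeSegment e) ∨
          ∃ T ∈ (a, b, c) :: L, x ∈ openTriangle T.1 T.2.1 T.2.2 :=
        fun hx => Or.inr (Or.inr ⟨_, List.mem_cons_self, hx⟩)
      rintro (hx | ⟨e, he, hx⟩ | ⟨T, hT, hx⟩)
      · rcases Finset.mem_insert.1 hx with rfl | hx
        · exact hO' hqO
        · exact Or.inl hx
      · rcases (hE e).1 he with ⟨w, hw, rfl⟩ | he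
        · rcases hseg w hw x hx with rfl | hx
          · exact Or.inl (hvert _ hw)
          · exact hO' hx
        · exact Or.inr (Or.inl ⟨e, he, hx⟩)
      · rcases (hL T).1 hT with hT | hT
        · exact hO' (hsub T hT x hx).1
        · exact Or.inr (Or.inr ⟨T, List.mem_cons_of_mem _ hT, hx⟩)
  -- One more vertex, two more triangles.
  · have := h.card
    rw [Finset.card_insert_of_notMem hqP]
    simp only [List.length_cons] at *
    omega

end Triangulations

/-! ### The extremal triangulations and maximality of their cacti. -/

section Extremal

theorem SimpleGraph.Reachable.eq_of_isolated {V : Type*} {C : SimpleGraph V} {u v : V}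
    (h : C.Reachable u v) (hu : ∀ w, ¬ C.Adj u w) : u = v := by
  obtain ⟨p⟩ := h
  cases p with
  | nil => rfl
  | cons h _ => exact absurd h (hu _)

theorem allCyclesTriangles_bot {V : Type*} : AllCyclesTriangles (⊥ : SimpleGraph V) := by
  refine ⟨fun u p hp => ?_, by simp⟩
  cases p with
  | nil => exact absurd hp Walk.not_isCycle_nil
  | cons h _ => exact absurd h (by simp)

/-- A connected triangular cactus is maximal if its vertex set covers all edges. -/
theorem isMaximalCactus_of_reachable {V : Type*} {G C : SimpleGraph V} {M : Set V} (hCG : C ≤ G)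
    (hC : AllCyclesTriangles C) (hM : ∀ u ∈ M, ∀ v ∈ M, C.Reachable u v)
    (hG : ∀ u v, G.Adj u v → u ∈ M ∨ v ∈ M) : IsMaximalCactus G C := by
  refine ⟨⟨hCG, isTriangularCactus_iff.2 hC⟩, ?_⟩
  rintro D ⟨hDG, hD⟩ hCD
  rw [isTriangularCactus_iff] at hD
  -- A triangle of a larger `D` with two vertices `x, y` in `M` is in `C`: a path of `C` from `y` to
  -- `x` and a missing edge `xy` would form a cycle of `D`, so the path is `y w x`. The triangle of
  -- `C` on `yw` must have apex `x`, by uniqueness of common neighbours in `D`, and so contains `xy`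
  -- after all.
  have key : ∀ x y z, x ∈ M → y ∈ M → D.Adj x y → D.Adj y z → D.Adj z x →
      C.Adj x y ∧ C.Adj y z ∧ C.Adj z x := by
    intro x y z hx hy hxy hyz hzx
    have hadj : C.Adj x y := by
      by_contra hn
      obtain ⟨r, hr⟩ := (hM y hy x hx).exists_isPath
      have hc : (Walk.cons hxy (r.mapLe hCD)).IsCycle := by
        rw [Walk.cons_isCycle_iff]
        refine ⟨hr.mapLe hCD, ?_⟩
        rw [Walk.edges_mapLe_eq_edges]
        exact fun h => hn (r.adj_of_mem_edges h)
      have hlen : r.length = 2 := by simpa using hD.1 _ _ hc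
      match r, hlen with
      | .cons (v := w) hyw (.cons hwx .nil), _ =>
        obtain ⟨v, hwv, hvy⟩ := hC.2 _ _ hyw
        obtain rfl := hD.common_neighbor_unique (hCD hyw) (hCD hwv) (hCD hvy) (hCD hwx) hxy
        exact hn hvy
    obtain ⟨w, hyw, hwx⟩ := hC.2 _ _ hadj
    obtain rfl := hD.common_neighbor_unique hxy hyz hzx (hCD hyw) (hCD hwx)
    exact ⟨hadj, hyw, hwx⟩
  intro a b hab
  obtain ⟨c, hbc, hca⟩ := hD.2 a b hab
  have h1 := hG _ _ (hDG hab)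
  have h2 := hG _ _ (hDG hbc)
  have h3 := hG _ _ (hDG hca)
  -- Since `M` covers the edges of `G`, at most one vertex of the triangle lies outside `M`.
  by_cases ha : a ∈ M
  · by_cases hb : b ∈ M
    · exact (key a b c ha hb hab hbc hca).1
    · exact (key c a b (h2.resolve_left hb) ha hca hab hbc).2.1
  · exact (key b c a (h1.resolve_left ha) (h3.resolve_right ha) hbc hca hab).2.2

variable {a₀ b₀ c₀ : ℝ × ℝ}

/-- Triangulations with a spanning triangular cactus. -/
theorem exists_isTriangulation_spanning_cactus (h₀ : 0 < cross a₀ b₀ c₀) (t : ℕ) :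
    ∃ P E L, ∃ C : SimpleGraph (ℝ × ℝ), IsTriangulation a₀ b₀ c₀ P E L ∧ P.card = 2 * t + 3 ∧
      AllCyclesTriangles C ∧ (∀ u v, C.Adj u v → s(u, v) ∈ E) ∧
      ∀ u ∈ P, ∀ v ∈ P, C.Reachable u v := by
  induction t with
  | zero =>
    have h := isTriangulation_triangle h₀
    have hcard := h.card
    have nd := h.not_isDiag
    simp only [Set.mem_insert_iff, Set.mem_singleton_iff, forall_eq_or_imp, forall_eq,
      Sym2.mk_isDiag_iff] at nd
    refine ⟨_, _, _, ⊥ ⊔ completeOn {a₀, b₀, c₀}, h, ?_, ?_, ?_, ?_⟩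
    · simp only [List.length_singleton] at hcard
      omega
    · refine allCyclesTriangles_bot.sup_completeOn ?_ ?_ ?_ <;> rw [reachable_bot] <;> tauto
    · rw [bot_sup_eq]
      rintro u v ⟨hne, (rfl | rfl | rfl), (rfl | rfl | rfl)⟩ <;>
        first | exact absurd rfl hne | simp
    · intro u hu v hv
      by_cases huv : u = v
      · exact huv ▸ .rfl
      · exact Adj.reachable (Or.inr ⟨huv, by simpa using hu, by simpa using hv⟩)
  | succ t ih =>
    obtain ⟨P, E, L, C, h, hP, hC, hCE, hr⟩ := ih
    obtain _ | ⟨⟨a, b, c⟩, L⟩ := L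
    · have := h.card
      simp only [List.length_nil] at this
      omega
    have ha : a ∈ P := h.mem_of_edge _ (h.edges _ List.mem_cons_self).1 _ (by simp)
    have h1 := h.insert_centroid
    have h2 := h1.insert_centroid
    have n1 : centroid a b c ∉ P := (h.empty _ List.mem_cons_self _
      (centroid_mem_openTriangle (h.pos _ List.mem_cons_self))).1
    -- The second vertex goes into the face `a b w`, where `w` is the first new vertex; with `z` the
    -- second, `a w z` becomes a triangle hanging on the old cactus at `a`.
    have n2 : centroid a b (centroid a b c) ∉ insert (centroid a b c) P :=
      (h1.empty _ List.mem_cons_self _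
        (centroid_mem_openTriangle (h1.pos _ List.mem_cons_self))).1
    generalize centroid a b c = w at *
    generalize centroid a b w = z at *
    rw [Finset.mem_insert, not_or] at n2
    have hCP : ∀ u v, C.Adj u v → u ∈ P := fun u v huv => h.mem_of_edge _ (hCE u v huv) u (by simp)
    have iw : ∀ v, w ≠ v → ¬ C.Reachable w v := fun v hv hr =>
      hv (hr.eq_of_isolated fun x hx => n1 (hCP _ _ hx))
    have iz : ∀ v, z ≠ v → ¬ C.Reachable z v := fun v hv hr =>
      hv (hr.eq_of_isolated fun x hx => n2.2 (hCP _ _ hx))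
    have naw : w ≠ a := by rintro rfl; exact n1 ha
    have naz : z ≠ a := by rintro rfl; exact n2.2 ha
    refine ⟨_, _, _, C ⊔ completeOn {a, w, z}, h2, ?_, ?_, ?_, ?_⟩
    · rw [Finset.card_insert_of_notMem (by simp [n2]), Finset.card_insert_of_notMem n1]
      omega
    · exact hC.sup_completeOn (fun hr => iw a naw hr.symm) (fun hr => iz w n2.1 hr.symm)
        (iz a naz)
    · rintro u v (huv | ⟨hne, (rfl | rfl | rfl), (rfl | rfl | rfl)⟩)
      · simp [hCE u v huv]
      all_goals first | exact absurd rfl hne | simp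
    · have hreach : ∀ u ∈ insert z (insert w P), (C ⊔ completeOn {a, w, z}).Reachable a u := by
        intro u hu
        simp only [Finset.mem_insert] at hu
        rcases hu with rfl | rfl | hu
        · exact Adj.reachable (Or.inr ⟨naz.symm, by simp, by simp⟩)
        · exact Adj.reachable (Or.inr ⟨naw.symm, by simp, by simp⟩)
        · exact (hr a ha u hu).mono le_sup_left
      exact fun u hu v hv => (hreach u hu).symm.trans (hreach v hv)

/-- Subdividing `k` triangles of a triangulation. -/
theorem IsTriangulation.exists_subdivision {P : Finset (ℝ × ℝ)} {E : Set (Sym2 (ℝ × ℝ))}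
    {L : List ((ℝ × ℝ) × (ℝ × ℝ) × (ℝ × ℝ))} (h : IsTriangulation a₀ b₀ c₀ P E L) (k : ℕ)
    (hk : k ≤ L.length) :
    ∃ P' E' L', IsTriangulation a₀ b₀ c₀ P' E' L' ∧ P'.card = P.card + k ∧ P ⊆ P' ∧ E ⊆ E' ∧
      ∀ e ∈ E', ∃ v ∈ e, v ∈ P := by
  -- `R` lists the original faces not yet subdivided. Only these are used, so new vertices are
  -- joined to vertices of `P` alone and never to each other.
  suffices ∃ P' E' R D, IsTriangulation a₀ b₀ c₀ P' E' (R ++ D) ∧ R.length + k = L.length ∧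
      (∀ T ∈ R, T.1 ∈ P ∧ T.2.1 ∈ P ∧ T.2.2 ∈ P) ∧ P'.card = P.card + k ∧ P ⊆ P' ∧ E ⊆ E' ∧
      ∀ e ∈ E', ∃ v ∈ e, v ∈ P by
    obtain ⟨P', E', R, D, h, -, -, h'⟩ := this
    exact ⟨P', E', R ++ D, h, h'⟩
  induction k with
  | zero =>
    refine ⟨P, E, L, [], by simpa using h, by simp, fun T hT => ?_, rfl, subset_rfl, subset_rfl,
      fun e he => ?_⟩
    · obtain ⟨h1, h2, -⟩ := h.edges T hT
      exact ⟨h.mem_of_edge _ h1 _ (by simp), h.mem_of_edge _ h1 _ (by simp),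
        h.mem_of_edge _ h2 _ (by simp)⟩
    · induction e with | _ u v
      exact ⟨u, by simp, h.mem_of_edge _ he u (by simp)⟩
  | succ k ih =>
    obtain ⟨P', E', R, D, h', hlen, hR, hcard, hP, hE, hv⟩ := ih (by omega)
    obtain _ | ⟨⟨a, b, c⟩, R⟩ := R
    · simp only [List.length_nil] at hlen
      omega
    obtain ⟨ha, hb, hc⟩ := hR _ List.mem_cons_self
    have h1 : IsTriangulation a₀ b₀ c₀ P' E' ((a, b, c) :: (R ++ D)) := h'
    have n1 : centroid a b c ∉ P' := (h1.empty _ List.mem_cons_self _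
      (centroid_mem_openTriangle (h1.pos _ List.mem_cons_self))).1
    refine ⟨_, _, R, [(a, b, centroid a b c), (b, c, centroid a b c), (c, a, centroid a b c)] ++ D,
      h1.insert_centroid.perm ?_, ?_, fun T hT => hR T (List.mem_cons_of_mem _ hT), ?_,
      hP.trans (Finset.subset_insert _ _), fun e he => by simp [hE he], ?_⟩
    · exact List.perm_append_comm_assoc [_, _, _] R D
    · simp only [List.length_cons] at hlen
      omega
    · rw [Finset.card_insert_of_notMem n1]
      omega
    · rintro e (rfl | rfl | rfl | he)
      · exact ⟨a, by simp, ha⟩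
      · exact ⟨b, by simp, hb⟩
      · exact ⟨c, by simp, hc⟩
      · exact hv e he

end Extremal

/-! ### From triangulations to plane graphs and their faces. -/

section Drawing

/-- A connected set that avoids the frontier of `F` cannot meet both `F` and the complement of its
closure. -/
theorem connectedComponentIn_eq_of_frontier_subset {X : Type*} [TopologicalSpace X] {F S : Set X}
    {x : X} (hF : IsPreconnected F) (hFo : IsOpen F) (hx : x ∈ F) (hFS : F ⊆ Sᶜ)
    (hfr : frontier F ⊆ S) : connectedComponentIn Sᶜ x = F := by
  refine subset_antisymm ?_ (hF.subset_connectedComponentIn hx hFS)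
  intro y hy
  by_contra hyF
  have hyc : y ∈ (closure F)ᶜ := fun hc =>
    connectedComponentIn_subset _ _ hy (hfr (hFo.frontier_eq ▸ ⟨hc, hyF⟩))
  obtain ⟨z, -, hz, hz'⟩ := isPreconnected_connectedComponentIn (F := Sᶜ) (x := x) F (closure F)ᶜ
    hFo isClosed_closure.isOpen_compl (fun z hz => by
      by_cases hzF : z ∈ F
      · exact Or.inl hzF
      · exact Or.inr fun hc =>
          connectedComponentIn_subset _ _ hz (hfr (hFo.frontier_eq ▸ ⟨hc, hzF⟩)))
    ⟨x, mem_connectedComponentIn (hFS hx), hx⟩ ⟨y, hy, hyc⟩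
  exact hz' (subset_closure hz)

/-- Each connected piece lies in a single component, so there are at most as many components as
pieces. -/
theorem finite_connectedComponentIn_of_cover {X : Type*} [TopologicalSpace X] {U : Set X}
    {A : Set (Set X)} (hA : A.Finite) (hconn : ∀ B ∈ A, IsPreconnected B ∧ B ⊆ U)
    (hU : ∀ x ∈ U, ∃ B ∈ A, x ∈ B) : {F | ∃ x ∈ U, F = connectedComponentIn U x}.Finite := by
  classical
  refine (hA.image fun B => if h : B.Nonempty then connectedComponentIn U h.some else ∅).subset ?_
  rintro _ ⟨x, hx, rfl⟩
  obtain ⟨B, hB, hxB⟩ := hU x hx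
  have hne : B.Nonempty := ⟨x, hxB⟩
  refine ⟨B, hB, ?_⟩
  simp only [hne, dif_pos]
  exact connectedComponentIn_eq
    ((hconn B hB).1.subset_connectedComponentIn hne.some_mem (hconn B hB).2 hxB)

variable {a₀ b₀ c₀ : ℝ × ℝ} {P : Finset (ℝ × ℝ)} {E : Set (Sym2 (ℝ × ℝ))}
  {L : List ((ℝ × ℝ) × (ℝ × ℝ) × (ℝ × ℝ))}

/-- The plane graph of a triangulation. -/
def IsTriangulation.planeGraph {V : Type*} (h : IsTriangulation a₀ b₀ c₀ P E L) (p : V → ℝ × ℝ)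
    (hp : Function.Injective p) (hP : ∀ x, x ∈ P ↔ ∃ v, p v = x) : PlaneGraph V where
  graph :=
    { Adj := fun u v => s(p u, p v) ∈ E
      symm := ⟨fun u v huv => by rwa [Sym2.eq_swap]⟩
      loopless := ⟨fun u hu => h.not_isDiag _ hu rfl⟩ }
  pos := p
  arc e := edgeSegment (e.map p)
  pos_injective := hp
  arc_isArc u v huv := by
    have hne : p u ≠ p v := fun he => h.not_isDiag _ huv he
    refine ⟨Path.segment (p u) (p v), ?_, by simp⟩
    intro s t hst
    exact Subtype.ext (AffineMap.lineMap_injective ℝ hne hst)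
  mem_of_pos_mem_arc e he w hw := by
    induction e with | _ u v
    have := h.vertex _ he (p w) ((hP _).2 ⟨w, rfl⟩) hw
    rw [Sym2.mem_iff] at this ⊢
    exact this.imp (@hp _ _) (@hp _ _)
  arc_inter_arc e he f hf hef x hx := by
    have hmem : ∀ e : Sym2 V, e ∈ SimpleGraph.edgeSet
        { Adj := fun u v => s(p u, p v) ∈ E
          symm := ⟨fun u v huv => by rwa [Sym2.eq_swap]⟩
          loopless := ⟨fun u hu => h.not_isDiag _ hu rfl⟩ } → e.map p ∈ E := by
      intro e he
      induction e with | _ u v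
      exact he
    have hxP := h.inter _ (hmem e he) _ (hmem f hf) (fun hh => hef (Sym2.map.injective hp hh)) x
      hx.1 hx.2
    obtain ⟨w, rfl⟩ := (hP _).1 hxP
    have key : ∀ e : Sym2 V, e.map p ∈ E → p w ∈ edgeSegment (e.map p) → w ∈ e := by
      intro e he hw
      obtain ⟨v, hv, hvw⟩ := Sym2.mem_map.1 (h.vertex _ he (p w) hxP hw)
      exact hp hvw ▸ hv
    exact ⟨w, key e (hmem e he) hx.1, key f (hmem f hf) hx.2, rfl⟩

variable {V : Type*} {p : V → ℝ × ℝ}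

theorem IsTriangulation.mem_support_planeGraph (h : IsTriangulation a₀ b₀ c₀ P E L)
    (hp : Function.Injective p) (hP : ∀ x, x ∈ P ↔ ∃ v, p v = x) (x : ℝ × ℝ) :
    x ∈ (h.planeGraph p hp hP).support ↔ x ∈ P ∨ ∃ e ∈ E, x ∈ edgeSegment e := by
  rw [PlaneGraph.support, Set.mem_union, hP, Set.mem_range]
  refine or_congr Iff.rfl ?_
  simp only [Set.mem_iUnion, exists_prop]
  constructor
  · rintro ⟨e, he, hx⟩
    induction e with | _ u v
    exact ⟨_, he, hx⟩
  · rintro ⟨e, he, hx⟩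
    induction e with | _ a b
    obtain ⟨u, rfl⟩ := (hP a).1 (h.mem_of_edge _ he a (by simp))
    obtain ⟨v, rfl⟩ := (hP b).1 (h.mem_of_edge _ he b (by simp))
    exact ⟨s(u, v), he, hx⟩

theorem IsTriangulation.isTriangularFace (h : IsTriangulation a₀ b₀ c₀ P E L)
    (hp : Function.Injective p) (hP : ∀ x, x ∈ P ↔ ∃ v, p v = x) :
    ∀ T ∈ L, (h.planeGraph p hp hP).IsTriangularFace (openTriangle T.1 T.2.1 T.2.2) := by
  rintro ⟨a, b, c⟩ hT
  have hpos : 0 < cross a b c := h.pos _ hT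
  obtain ⟨hab, hbc, hca⟩ : s(a, b) ∈ E ∧ s(b, c) ∈ E ∧ s(c, a) ∈ E := h.edges _ hT
  have hfr := frontier_openTriangle hpos
  have hsub : openTriangle a b c ⊆ (h.planeGraph p hp hP).supportᶜ := by
    intro x hx hxs
    obtain ⟨h1, h2⟩ := h.empty _ hT x hx
    rcases (h.mem_support_planeGraph hp hP x).1 hxs with h3 | ⟨e, he, hxe⟩
    · exact h1 h3
    · exact h2 e he hxe
  constructor
  · refine ⟨_, hsub (centroid_mem_openTriangle hpos), Eq.symm ?_⟩
    refine connectedComponentIn_eq_of_frontier_subset (convex_openTriangle a b c).isPreconnected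
      (isOpen_openTriangle a b c) (centroid_mem_openTriangle hpos) hsub ?_
    rw [hfr]
    rintro x ((hx | hx) | hx) <;> rw [h.mem_support_planeGraph]
    · exact Or.inr ⟨_, hab, hx⟩
    · exact Or.inr ⟨_, hbc, hx⟩
    · exact Or.inr ⟨_, hca, hx⟩
  · obtain ⟨u, rfl⟩ := (hP a).1 (h.mem_of_edge _ hab a (by simp))
    obtain ⟨v, rfl⟩ := (hP b).1 (h.mem_of_edge _ hab b (by simp))
    obtain ⟨w, rfl⟩ := (hP c).1 (h.mem_of_edge _ hbc c (by simp))
    refine ⟨u, v, w, hab, hbc, ?_, ?_⟩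
    · rw [Sym2.eq_swap] at hca
      exact hca
    · rw [hfr, segment_symm ℝ (p w)]
      rfl

/-- Needed because `f₃` is an `ncard`, which would be 0 on an infinite set. The open triangles,
together with three open half-planes covering the outside, meet every face. -/
theorem IsTriangulation.finite_isFace (h : IsTriangulation a₀ b₀ c₀ P E L)
    (hp : Function.Injective p) (hP : ∀ x, x ∈ P ↔ ∃ v, p v = x) :
    {F | (h.planeGraph p hp hP).IsFace F}.Finite := by
  have hext : ∀ x ∉ closedTriangle a₀ b₀ c₀, x ∈ (h.planeGraph p hp hP).supportᶜ := by
    intro x hx hxs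
    rw [h.cover] at hx
    rcases (h.mem_support_planeGraph hp hP x).1 hxs with h3 | h3
    · exact hx (Or.inl h3)
    · exact hx (Or.inr (Or.inl h3))
  refine finite_connectedComponentIn_of_cover (A := {B | ∃ T ∈ L, B = openTriangle T.1 T.2.1 T.2.2} ∪
    {{x | cross b₀ c₀ x < 0}, {x | cross c₀ a₀ x < 0}, {x | cross a₀ b₀ x < 0}}) ?_ ?_ ?_
  · refine Set.Finite.union ?_ (by simp)
    exact (L.finite_toSet.image fun T => openTriangle T.1 T.2.1 T.2.2).subset
      fun B ⟨T, hT, hB⟩ => ⟨T, hT, hB.symm⟩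
  · rintro B (⟨T, hT, rfl⟩ | rfl | rfl | rfl)
    · refine ⟨(convex_openTriangle _ _ _).isPreconnected, fun x hx hxs => ?_⟩
      obtain ⟨h1, h2⟩ := h.empty _ hT x hx
      rcases (h.mem_support_planeGraph hp hP x).1 hxs with h3 | ⟨e, he, hxe⟩
      · exact h1 h3
      · exact h2 e he hxe
    · exact ⟨(convex_cross_neg _ _).isPreconnected, fun x hx => hext x fun hc => not_lt.2 hc.1 hx⟩
    · exact ⟨(convex_cross_neg _ _).isPreconnected, fun x hx => hext x fun hc => not_lt.2 hc.2.1 hx⟩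
    · exact ⟨(convex_cross_neg _ _).isPreconnected, fun x hx => hext x fun hc => not_lt.2 hc.2.2 hx⟩
  · intro x hx
    by_cases hc : x ∈ closedTriangle a₀ b₀ c₀
    · rw [h.cover, ← or_assoc] at hc
      rcases hc with hc | ⟨T, hT, hxT⟩
      · exact absurd ((h.mem_support_planeGraph hp hP x).2 hc) hx
      · exact ⟨_, Or.inl ⟨T, hT, rfl⟩, hxT⟩
    · simp only [closedTriangle, Set.mem_ofPred_eq, not_and_or, not_le] at hc
      rcases hc with hc | hc | hc
      · exact ⟨_, Or.inr (Or.inl rfl), hc⟩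
      · exact ⟨_, Or.inr (Or.inr (Or.inl rfl)), hc⟩
      · exact ⟨_, Or.inr (Or.inr (Or.inr rfl)), hc⟩

/-- The listed triangles are pairwise disjoint and nonempty, hence distinct faces. The unbounded
face is left out: a lower bound suffices. -/
theorem IsTriangulation.length_le_f₃ (h : IsTriangulation a₀ b₀ c₀ P E L)
    (hp : Function.Injective p) (hP : ∀ x, x ∈ P ↔ ∃ v, p v = x) :
    L.length ≤ (h.planeGraph p hp hP).f₃ := by
  classical
  have hnd : (L.map fun T => openTriangle T.1 T.2.1 T.2.2).Nodup := by
    rw [List.Nodup, List.pairwise_map]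
    refine h.disjoint.imp_of_mem fun {T T'} hT _ hd heq => ?_
    have hm := centroid_mem_openTriangle (h.pos T hT)
    exact Set.disjoint_left.1 hd hm (heq ▸ hm)
  rw [PlaneGraph.f₃, ← List.length_map (f := fun T => openTriangle T.1 T.2.1 T.2.2),
    ← List.toFinset_card_of_nodup hnd, ← Set.ncard_coe_finset]
  refine Set.ncard_le_ncard ?_ ((h.finite_isFace hp hP).subset fun F hF => hF.1)
  intro F hF
  simp only [List.coe_toFinset, List.mem_map, Set.mem_ofPred_eq] at hF
  obtain ⟨T, hT, rfl⟩ := hF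
  exact h.isTriangularFace hp hP T hT

end Drawing

/-! ### The family indexed by the number of vertices. -/

section Family

/-- The cactus is built on all points of the plane, and is pulled back along the labelling of the
vertices. Nothing is lost, since all its non-isolated points are labelled. -/
theorem SimpleGraph.Reachable.comap {V W : Type*} {C : SimpleGraph W} {p : V → W}
    (hp : Function.Injective p) (hC : ∀ u v, C.Adj u v → ∃ i, p i = u) {i j : V}
    (h : C.Reachable (p i) (p j)) : (C.comap p).Reachable i j := by
  obtain ⟨w⟩ := h
  suffices ∀ x y, C.Walk x y → ∀ i, p i = x → p j = y → (C.comap p).Reachable i j from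
    this _ _ w i rfl rfl
  intro x y w
  induction w with
  | nil =>
    rintro i hi hj
    exact hp (hi.trans hj.symm) ▸ .rfl
  | @cons x z y hxz w ih =>
    rintro i rfl hj
    obtain ⟨k, rfl⟩ := hC _ _ hxz.symm
    exact (Adj.reachable (G := C.comap p) hxz).trans (ih k rfl hj)

theorem AllCyclesTriangles.comap {V W : Type*} {C : SimpleGraph W} (h : AllCyclesTriangles C)
    {p : V → W} (hp : Function.Injective p) (hC : ∀ u v, C.Adj u v → ∃ i, p i = u) :
    AllCyclesTriangles (C.comap p) := by
  constructor
  · intro u w hw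
    have := h.1 _ _ ((Walk.isCycle_map_iff_of_injective (f := Hom.comap p C) hp).2 hw)
    simpa using this
  · intro a b hab
    obtain ⟨c, hbc, hca⟩ := h.2 _ _ hab
    obtain ⟨k, rfl⟩ := hC _ _ hca
    exact ⟨k, hbc, hca⟩

theorem exists_planeGraph_isMaximalCactus (n : ℕ) (hn : 5 ≤ n) :
    ∃ (H : PlaneGraph (Fin n)) (C : SimpleGraph (Fin n)), IsMaximalCactus H.graph C ∧
      2 * n ≤ H.f₃ + 5 ∧ 12 * numTriangles C ≤ 2 * n + 20 := by
  classical
  have h₀ : 0 < cross (0, 0) (1, 0) (0, 1) := by norm_num [cross]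
  obtain ⟨P, E, L, C, h, hP, hC, hCE, hr⟩ :=
    -- This is the least `t` for which `|P| = 2t + 3` satisfies `n - |P| ≤ 2|P| - 5`, so that there
    -- are enough faces to place the remaining vertices.
    exists_isTriangulation_spanning_cactus h₀ ((n + 7) / 6 - 1)
  have hL := h.card
  obtain ⟨P', E', L', h', hP', hPP, hEE, hE'⟩ :=
    h.exists_subdivision (n - P.card) (by omega)
  have hcard : P'.card = n := by omega
  let e : Fin n ≃ P' := (P'.equivFinOfCardEq hcard).symm
  let p : Fin n → ℝ × ℝ := fun i => e i
  have hp : Function.Injective p := Subtype.val_injective.comp e.injective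
  have hrange : ∀ x, x ∈ P' ↔ ∃ v, p v = x := by
    intro x
    constructor
    · exact fun hx => ⟨e.symm ⟨x, hx⟩, by simp [p]⟩
    · rintro ⟨v, rfl⟩
      exact (e v).2
  have hCP : ∀ u v, C.Adj u v → u ∈ P := fun u v huv => h.mem_of_edge _ (hCE u v huv) u (by simp)
  have hCp : ∀ u v, C.Adj u v → ∃ i, p i = u := fun u v huv => (hrange u).1 (hPP (hCP u v huv))
  have hCF := hC.comap hp hCp
  refine ⟨h'.planeGraph p hp hrange, C.comap p, ?_, ?_, ?_⟩
  · refine isMaximalCactus_of_reachable (M := {i | p i ∈ P}) ?_ hCF ?_ ?_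
    · exact fun i j hij => hEE (hCE _ _ hij)
    · exact fun i hi j hj => (hr _ hi _ hj).comap hp hCp
    · intro i j hij
      obtain ⟨v, hv, hvP⟩ := hE' _ hij
      rcases Sym2.mem_iff.1 hv with rfl | rfl
      · exact Or.inl hvP
      · exact Or.inr hvP
  · have h1 := h'.length_le_f₃ hp hrange
    have h2 := h'.card
    omega
  · have h1 := (isTriangularCactus_iff.2 hCF).1.two_mul_numTriangles_le
      (Finset.univ.filter fun i => p i ∈ P) (fun i j hij => by simpa using hCP _ _ hij)
    have h2 : (Finset.univ.filter fun i => p i ∈ P).card ≤ P.card :=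
      Finset.card_le_card_of_injOn p (fun i hi => by simpa using hi) hp.injOn
    omega

/-- The plane graph without edges. -/
def edgelessPlaneGraph (n : ℕ) : PlaneGraph (Fin n) where
  graph := ⊥
  pos i := (i, 0)
  arc _ := ∅
  pos_injective i j hij := by
    simp only [Prod.mk.injEq, and_true, Nat.cast_inj] at hij
    exact Fin.ext hij
  arc_isArc u v huv := absurd huv (by simp)
  mem_of_pos_mem_arc e he := absurd he (by simp)
  arc_inter_arc e he := absurd he (by simp)

theorem exists_family : ∃ H : (n : ℕ) → PlaneGraph (Fin n), HasPoorMaximalCacti H := by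
  have hex : ∀ n : ℕ, ∃ (H : PlaneGraph (Fin n)) (C : SimpleGraph (Fin n)),
      IsMaximalCactus H.graph C ∧
      (5 ≤ n → 2 * n ≤ H.f₃ + 5 ∧ 12 * numTriangles C ≤ 2 * n + 20) := by
    intro n
    by_cases hn : 5 ≤ n
    · obtain ⟨H, C, h1, h2⟩ := exists_planeGraph_isMaximalCactus n hn
      exact ⟨H, C, h1, fun _ => h2⟩
    -- The small `n` only have to be filled in, as the bounds are asymptotic.
    · exact ⟨edgelessPlaneGraph n, ⊥,
        ⟨⟨bot_le, isTriangularCactus_iff.2 allCyclesTriangles_bot⟩, fun D hD _ => hD.1⟩,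
        fun h => absurd h hn⟩
  choose H C hmax hbound using hex
  refine ⟨H, ?_, C, hmax,
    -- The positive part of the excess over 1/12 makes the bound hold for every `n`; it is squeezed
    -- between 0 and the generous `25 / n`.
    fun n => max ((numTriangles (C n) : ℝ) / ((H n).f₃ : ℝ) - 1 / 12) 0, ?_, fun n => ?_⟩
  · filter_upwards [eventually_ge_atTop 5] with n hn
    have := (hbound n hn).1
    omega
  · refine tendsto_of_tendsto_of_tendsto_of_le_of_le' tendsto_const_nhds
      (tendsto_const_div_atTop_nhds_zero_nat 25) (Eventually.of_forall fun n => le_max_right _ _) ?_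
    filter_upwards [eventually_ge_atTop 5] with n hn
    obtain ⟨h1, h2⟩ := hbound n hn
    have hn' : (5 : ℝ) ≤ n := by exact_mod_cast hn
    have h1' : (2 : ℝ) * n ≤ (H n).f₃ + 5 := by exact_mod_cast h1
    have h2' : (12 : ℝ) * numTriangles (C n) ≤ 2 * n + 20 := by exact_mod_cast h2
    have hf : (0 : ℝ) < (H n).f₃ := by linarith
    refine max_le ?_ (by positivity)
    rw [sub_le_iff_le_add, div_le_iff₀ hf]
    have h3 : (25 / n + 1 / 12 : ℝ) * (2 * n - 5) ≤ (25 / n + 1 / 12) * (H n).f₃ := by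
      gcongr
      linarith
    have h4 : (25 / n + 1 / 12 : ℝ) * (2 * n - 5) = 50 - 125 / n + (2 * n - 5) / 12 := by
      field_simp
      ring
    have h5 : (125 : ℝ) / n ≤ 25 := by
      rw [div_le_iff₀ (by linarith)]
      linarith
    linarith
  · have := le_max_left ((numTriangles (C n) : ℝ) / ((H n).f₃ : ℝ) - 1 / 12) 0
    linarith

theorem HasPoorMaximalCacti.cactusNumber_div_le {H : (n : ℕ) → PlaneGraph (Fin n)}
    (h : HasPoorMaximalCacti H) : ∃ δ : ℕ → ℝ, Tendsto δ atTop (𝓝 0) ∧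
      ∀ n, (cactusNumber (H n).graph : ℝ) / ((H n).f₃ : ℝ) ≤ 1 / 6 + δ n := by
  obtain ⟨-, C, hC, ε, hε, hle⟩ := h
  refine ⟨fun n => 2 * ε n, by simpa using hε.const_mul 2, fun n => ?_⟩
  have h1 : (cactusNumber (H n).graph : ℝ) ≤ 2 * numTriangles (C n) := by
    exact_mod_cast cactusNumber_le_two_mul_numTriangles (hC n)
  -- This also covers members without triangular faces, where both quotients are 0.
  have h2 := div_le_div_of_nonneg_right h1 (Nat.cast_nonneg (α := ℝ) (H n).f₃)
  rw [mul_div_assoc] at h2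
  have := hle n
  linarith

end Family

/-! ### The theorem. -/

theorem mainTheorem5 :
    -- there is a family as described, and it satisfies the bound
    (∃ H : (n : ℕ) → PlaneGraph (Fin n), HasPoorMaximalCacti H ∧
      ∃ δ : ℕ → ℝ, Tendsto δ atTop (𝓝 0) ∧
        ∀ n, (cactusNumber (H n).graph : ℝ) / ((H n).f₃ : ℝ) ≤ 1 / 6 + δ n) ∧
    -- every such family satisfies the bound
    (∀ H : (n : ℕ) → PlaneGraph (Fin n), HasPoorMaximalCacti H →
      ∃ δ : ℕ → ℝ, Tendsto δ atTop (𝓝 0) ∧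
        ∀ n, (cactusNumber (H n).graph : ℝ) / ((H n).f₃ : ℝ) ≤ 1 / 6 + δ n) ∧
    -- a maximal cactus has at least half as many triangles as a maximum one
    (∀ (V : Type*) [Finite V] (G C : SimpleGraph V), IsMaximalCactus G C →
      cactusNumber G ≤ 2 * numTriangles C) ∧
    -- the constant 1/6 cannot be improved
    (∀ c : ℝ, 1 / 6 < c →
      ∃ (n : ℕ) (H : PlaneGraph (Fin n)),
        (cactusNumber H.graph : ℝ) < c * (H.f₃ : ℝ)) := by
  obtain ⟨H, hH⟩ := exists_family
  refine ⟨⟨H, hH, hH.cactusNumber_div_le⟩, fun H hH => hH.cactusNumber_div_le,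
    fun V _ G C hC => cactusNumber_le_two_mul_numTriangles hC, fun c hc => ?_⟩
  obtain ⟨δ, hδ, hle⟩ := hH.cactusNumber_div_le
  -- Some `n` has both `δ n < c - 1/6` and a triangular face; the face makes the inequality strict
  -- after clearing the denominator.
  obtain ⟨n, hn, hf⟩ :=
    ((hδ.eventually (gt_mem_nhds (sub_pos.2 hc))).and hH.1).exists
  refine ⟨n, H n, ?_⟩
  rw [← div_lt_iff₀ (by exact_mod_cast hf)]
  have := hle n
  linarith
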